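/- Theorem (counterexample). There is a compact real-analytic foliated bundle over a compact Riemann surface carrying a real-analytic leafwise holomorphic function that is not leafwise constant. More precisely, let $SU(1,1)$ be the group of matrices $\begin{pmatrix}\alpha&\beta\\ \bar\beta&\bar\alpha\end{pmatrix}$ with $|\alpha|^2-|\beta|^2=1$. Let it act on the open unit disc $\mathbb D$ by $gz=(\alpha z+\beta)/(\bar\beta z+\bar\alpha)$ and on $\mathbb{R}P^4=\{[z_1,z_2,t] : 0\neq(z_1,z_2,t)\in\mathbb C^2\times\mathbb R\}$ by $g[z_1,z_2,t]=[\alpha z_1+\beta\bar z_2,\ \alpha z_2+\beta\bar z_1,\ t]$. The quadric $\mathcal C=\{[z_1,z_2,t] : |z_1|^2-|z_2|^2=t^2\}$ is an $SU(1,1)$-invariant compact connected real-analytic submanifold of $\mathbb{R}P^4$ of dimension $3$, and the function $$f:\mathbb D\times\mathcal C\to\mathbb C,\qquad f(z,[\alpha,\beta,t])=\frac{\bar\alpha z-\beta}{-\bar\beta z+\alpha},$$ satisfies $f(gz,gx)=f(z,x)$ for all $g\in SU(1,1)$. Torsion-free uniform lattices (discrete cocompact subgroups without non-trivial elements of finite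 order) of $SU(1,1)$ exist, and for every such $\Gamma$: (i) $S=\mathbb D/\Gamma$ is a compact connected Riemann surface with universal covering $\mathbb D\to S$ and deck group $\Gamma$, and $M=(\mathbb D\times\mathcal C)/\Gamma$ (diagonal action) is a compact connected real-analytic foliated bundle over $S$ with fibre $\mathcal C$: the natural projection $M\to S$ is a fibre bundle with fibre $\mathcal C$, and $M$ is a real-analytic manifold with a real-analytic foliation by Riemann surfaces, for which $\mathbb D\times\mathcal C\to M$ is a local isomorphism of foliated manifolds and the leaves are the images of the sets $\mathbb D\times\{x\}$, $x\in\mathcal C$; (ii) $f$ induces a function $F:M\to\mathbb C$ which is real-analytic and holomorphic along the leaves, and which is not leafwise constant: there is a leaf on which $F$ is not constant. -/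

import Mathlib

open scoped Manifold ContDiff Topology LinearAlgebra.Projectivization ComplexConjugate

noncomputable section

/-! ## The group `SU(1,1)` and its uniform lattices -/

/-- `SU(1,1)`: the matrices `!![α, β; conj β, conj α]` with `|α|² - |β|² = 1`. -/
def SU11 : Subgroup (Matrix.SpecialLinearGroup (Fin 2) ℂ) where
  carrier := {g | g.1 1 0 = conj (g.1 0 1) ∧ g.1 1 1 = conj (g.1 0 0)}
  one_mem' := by simp
  mul_mem' := by
    rintro g h ⟨hg1, hg2⟩ ⟨hh1, hh2⟩
    simp only [Set.mem_ofPred_eq, Matrix.SpecialLinearGroup.coe_mul, Matrix.mul_apply,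
      Fin.sum_univ_two, hg1, hg2, hh1, hh2, map_add, map_mul, Complex.conj_conj]
    constructor <;> ring
  inv_mem' := by
    rintro g ⟨hg1, hg2⟩
    simp [Matrix.SpecialLinearGroup.coe_inv, Matrix.adjugate_fin_two, hg1, hg2]

namespace SU11

/-- The entry `α` of `!![α, β; conj β, conj α]`. -/
def a (g : SU11) : ℂ := g.1.1 0 0

/-- The entry `β` of `!![α, β; conj β, conj α]`. -/
def b (g : SU11) : ℂ := g.1.1 0 1

lemma a_one : a 1 = 1 := by simp [a]

lemma b_one : b 1 = 0 := by simp [b]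

lemma a_mul (g h : SU11) : a (g * h) = a g * a h + b g * conj (b h) := by
  simp [a, b, Matrix.mul_apply, Fin.sum_univ_two, h.2.1]

lemma b_mul (g h : SU11) : b (g * h) = a g * b h + b g * conj (a h) := by
  simp [a, b, Matrix.mul_apply, Fin.sum_univ_two, h.2.2]

lemma normSq_sub (g : SU11) : Complex.normSq (a g) - Complex.normSq (b g) = 1 := by
  have h := g.1.2
  rw [Matrix.det_fin_two, g.2.1, g.2.2, Complex.mul_conj, Complex.mul_conj] at h
  exact_mod_cast h

end SU11

/-- A torsion-free uniform lattice of `SU(1,1)`: a discrete cocompact subgroup without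
non-trivial elements of finite order. -/
structure IsTorsionFreeUniformLattice (Γ : Subgroup SU11) : Prop where
  discrete : DiscreteTopology Γ
  cocompact : CompactSpace (SU11 ⧸ Γ)
  torsionFree : ∀ γ ∈ Γ, IsOfFinOrder γ → γ = 1

/-! ## The unit disc with the Möbius action -/

/-- The open unit disc of `ℂ`; as an open subset of `ℂ` it is a complex (and a real-analytic)
manifold. -/
def Disc : TopologicalSpace.Opens ℂ := ⟨Metric.ball 0 1, Metric.isOpen_ball⟩

namespace Disc

lemma normSq_lt (z : Disc) : Complex.normSq (z : ℂ) < 1 := by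
  have h : ‖(z : ℂ)‖ < 1 := by simpa [Disc] using z.2
  rw [Complex.normSq_eq_norm_sq]
  nlinarith [norm_nonneg (z : ℂ)]

lemma normSq_identity (g : SU11) (z : ℂ) :
    Complex.normSq (conj (SU11.b g) * z + conj (SU11.a g)) - Complex.normSq (SU11.a g * z + SU11.b g)
      = 1 - Complex.normSq z := by
  have h := SU11.normSq_sub g
  simp only [Complex.normSq_apply, Complex.add_re, Complex.add_im, Complex.mul_re,
    Complex.mul_im, Complex.conj_re, Complex.conj_im] at h ⊢
  linear_combination (1 - (z.re * z.re + z.im * z.im)) * h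

lemma denom_ne (g : SU11) (z : Disc) : conj (SU11.b g) * (z : ℂ) + conj (SU11.a g) ≠ 0 := by
  intro h0
  have h := normSq_identity g z
  have hz := normSq_lt z
  rw [h0, map_zero] at h
  linarith [Complex.normSq_nonneg (SU11.a g * (z : ℂ) + SU11.b g)]

lemma moebius_mem (g : SU11) (z : Disc) :
    (SU11.a g * (z : ℂ) + SU11.b g) / (conj (SU11.b g) * (z : ℂ) + conj (SU11.a g)) ∈ Disc := by
  have h := normSq_identity g z
  have hz := normSq_lt z
  have h0 := Complex.normSq_pos.2 (denom_ne g z)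
  have h1 : Complex.normSq ((SU11.a g * (z : ℂ) + SU11.b g) / (conj (SU11.b g) * (z : ℂ) + conj (SU11.a g))) < 1 := by
    rw [map_div₀, div_lt_one h0]
    linarith
  rw [Complex.normSq_eq_norm_sq] at h1
  change _ ∈ Metric.ball (0 : ℂ) 1
  rw [mem_ball_zero_iff]
  nlinarith [norm_nonneg ((SU11.a g * (z : ℂ) + SU11.b g) / (conj (SU11.b g) * (z : ℂ) + conj (SU11.a g)))]

/-- The action `g • z = (α z + β) / (conj β z + conj α)`. -/
instance : MulAction SU11 Disc where
  smul g z := ⟨(SU11.a g * (z : ℂ) + SU11.b g) / (conj (SU11.b g) * (z : ℂ) + conj (SU11.a g)), moebius_mem g z⟩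
  one_smul z := by
    apply Subtype.ext
    change (SU11.a 1 * (z : ℂ) + SU11.b 1) / (conj (SU11.b 1) * (z : ℂ) + conj (SU11.a 1)) = z
    simp [SU11.a_one, SU11.b_one]
  mul_smul g h z := by
    apply Subtype.ext
    have hh := denom_ne h z
    have hg := denom_ne g ⟨_, moebius_mem h z⟩
    have hgh := denom_ne (g * h) z
    change (SU11.a (g * h) * (z : ℂ) + SU11.b (g * h)) /
        (conj (SU11.b (g * h)) * (z : ℂ) + conj (SU11.a (g * h))) =
      (SU11.a g * ((SU11.a h * (z : ℂ) + SU11.b h) / (conj (SU11.b h) * (z : ℂ) + conj (SU11.a h))) + SU11.b g) /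
        (conj (SU11.b g) * ((SU11.a h * (z : ℂ) + SU11.b h) / (conj (SU11.b h) * (z : ℂ) + conj (SU11.a h)))
          + conj (SU11.a g))
    rw [div_eq_div_iff hgh hg]
    simp only [SU11.a_mul, SU11.b_mul, map_add, map_mul, Complex.conj_conj]
    field_simp
    ring

end Disc

/-! ## Real projective space, with its quotient topology and its affine charts -/

section Projective

variable {V : Type*} [NormedAddCommGroup V] [NormedSpace ℝ V] {n : ℕ}

/-- The quotient topology on the projectivization of a real normed space. -/
instance projTopology : TopologicalSpace (ℙ ℝ V) :=
  TopologicalSpace.coinduced (Projectivization.mk' ℝ) inferInstance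

lemma isQuotientMap_projMk : Topology.IsQuotientMap (Projectivization.mk' ℝ (V := V)) :=
  ⟨⟨rfl⟩, Quotient.mk''_surjective⟩

/-- The standard affine chart `[v] ↦ (vⱼ / vᵢ)_{j ≠ i}` of a real projective space, in terms of
linear coordinates `c` of the underlying vector space. -/
def projChart (c : V ≃L[ℝ] (Fin (n + 1) → ℝ)) (i : Fin (n + 1)) :
    OpenPartialHomeomorph (ℙ ℝ V) (EuclideanSpace ℝ (Fin n)) where
  toFun := Projectivization.lift
    (fun v => WithLp.toLp 2 (fun j => c v.1 (i.succAbove j) / c v.1 i)) (by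
      rintro ⟨v, hv⟩ ⟨w, hw⟩ t (rfl : v = t • w)
      have ht : t ≠ 0 := fun h => hv (by simp [h])
      congr 1
      funext j
      simp [mul_div_mul_left _ _ ht])
  invFun y := Projectivization.mk ℝ (c.symm (i.insertNth 1 (fun j => y j))) (by
      intro h
      have h1 : (i.insertNth (1 : ℝ) (fun j => y j) : Fin (n + 1) → ℝ) = 0 := by simpa using h
      simpa using congrFun h1 i)
  source := {p | Projectivization.lift (fun v => c v.1 i ≠ 0) (by
      rintro ⟨v, hv⟩ ⟨w, hw⟩ t (rfl : v = t • w)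
      have ht : t ≠ 0 := fun h => hv (by simp [h])
      simp [ht]) p}
  target := Set.univ
  map_source' _ _ := Set.mem_univ _
  map_target' y _ := by simp
  left_inv' := by
    intro p
    induction p with
    | h v hv =>
      intro hp
      have hi : c v i ≠ 0 := hp
      simp only [Projectivization.lift_mk]
      rw [Projectivization.mk_eq_mk_iff']
      refine ⟨(c v i)⁻¹, ?_⟩
      apply c.injective
      rw [map_smul, ContinuousLinearEquiv.apply_symm_apply]
      funext k
      refine Fin.succAboveCases i ?_ (fun j => ?_) k
      · simp [hi]
      · simp [div_eq_inv_mul]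
  right_inv' y _ := by
    ext j
    simp
  open_source := by
    rw [← isQuotientMap_projMk.isOpen_preimage]
    have : Continuous fun v : {v : V // v ≠ 0} => c v.1 i := by fun_prop
    exact isOpen_ne.preimage this
  open_target := isOpen_univ
  continuousOn_toFun := by
    have hop : IsOpen {v : {v : V // v ≠ 0} | c v.1 i ≠ 0} := by
      have : Continuous fun v : {v : V // v ≠ 0} => c v.1 i := by fun_prop
      exact isOpen_ne.preimage this
    have hs : IsOpen {p : ℙ ℝ V | Projectivization.lift (fun v => c v.1 i ≠ 0) (by
      rintro ⟨v, hv⟩ ⟨w, hw⟩ t (rfl : v = t • w)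
      have ht : t ≠ 0 := fun h => hv (by simp [h])
      simp [ht]) p} := by
      rw [← isQuotientMap_projMk.isOpen_preimage]
      exact hop
    rw [isQuotientMap_projMk.continuousOn_isOpen_iff hs]
    change ContinuousOn (fun v : {v : V // v ≠ 0} =>
      WithLp.toLp 2 (fun j => c v.1 (i.succAbove j) / c v.1 i)) {v | c v.1 i ≠ 0}
    refine (PiLp.continuous_toLp 2 _).comp_continuousOn ?_
    refine continuousOn_pi.2 fun j => ContinuousOn.div ?_ ?_ fun v hv => hv
    · exact Continuous.continuousOn (by fun_prop)
    · exact Continuous.continuousOn (by fun_prop)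
  continuousOn_invFun := by
    refine Continuous.continuousOn ?_
    refine isQuotientMap_projMk.continuous.comp (Continuous.subtype_mk ?_ _)
    refine c.symm.continuous.comp ?_
    refine Continuous.finInsertNth i continuous_const ?_
    fun_prop

end Projective

/-- The real vector space `ℂ² × ℝ` of the homogeneous coordinates `(z₁, z₂, t)`. -/
abbrev HomCoords : Type := ℂ × ℂ × ℝ

/-- The five real coordinates `(re z₁, im z₁, re z₂, im z₂, t)`. -/
def realCoords : HomCoords ≃L[ℝ] (Fin (4 + 1) → ℝ) :=
  LinearEquiv.toContinuousLinearEquiv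
    { toFun := fun v => ![v.1.re, v.1.im, v.2.1.re, v.2.1.im, v.2.2]
      invFun := fun x => (⟨x 0, x 1⟩, ⟨x 2, x 3⟩, x 4)
      map_add' := fun v w => by ext k; fin_cases k <;> simp
      map_smul' := fun r v => by ext k; fin_cases k <;> simp
      left_inv := fun v => rfl
      right_inv := fun x => by ext k; fin_cases k <;> rfl }

/-- `ℝP⁴`, the points of which are written `[z₁, z₂, t]`. -/
abbrev RP4 : Type := ℙ ℝ HomCoords

lemma exists_mem_projChart_source (p : RP4) : ∃ i, p ∈ (projChart realCoords i).source := by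
  refine Projectivization.ind (fun v hv => ?_) p
  by_contra! h
  apply hv
  apply realCoords.injective
  funext i
  have hi := h i
  simpa [projChart] using hi

/-- The standard manifold structure of `ℝP⁴`, with its five affine charts. -/
instance : ChartedSpace (EuclideanSpace ℝ (Fin 4)) RP4 where
  atlas := Set.range (projChart realCoords)
  chartAt p := projChart realCoords (exists_mem_projChart_source p).choose
  mem_chart_source p := (exists_mem_projChart_source p).choose_spec
  chart_mem_atlas _ := ⟨_, rfl⟩

/-! ## The action of `SU(1,1)` on `ℝP⁴` and the quadric -/

/-- The linear action `g • (z₁, z₂, t) = (α z₁ + β conj z₂, α z₂ + β conj z₁, t)`. It induces the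
action of `SU(1,1)` on `ℝP⁴`. -/
instance : DistribMulAction SU11 HomCoords where
  smul g v := (SU11.a g * v.1 + SU11.b g * conj v.2.1, SU11.a g * v.2.1 + SU11.b g * conj v.1, v.2.2)
  one_smul v := by
    change (SU11.a 1 * v.1 + SU11.b 1 * conj v.2.1, SU11.a 1 * v.2.1 + SU11.b 1 * conj v.1,
      v.2.2) = v
    simp [SU11.a_one, SU11.b_one]
  mul_smul g h v := by
    change (SU11.a (g * h) * v.1 + SU11.b (g * h) * conj v.2.1,
        SU11.a (g * h) * v.2.1 + SU11.b (g * h) * conj v.1, v.2.2) =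
      (SU11.a g * (SU11.a h * v.1 + SU11.b h * conj v.2.1) + SU11.b g * conj (SU11.a h * v.2.1 + SU11.b h * conj v.1),
        SU11.a g * (SU11.a h * v.2.1 + SU11.b h * conj v.1) + SU11.b g * conj (SU11.a h * v.1 + SU11.b h * conj v.2.1), v.2.2)
    simp only [SU11.a_mul, SU11.b_mul, map_add, map_mul, Complex.conj_conj, Prod.mk.injEq,
      and_true]
    constructor <;> ring
  smul_zero g := by
    change (SU11.a g * (0 : ℂ) + SU11.b g * conj (0 : ℂ), SU11.a g * (0 : ℂ) + SU11.b g * conj (0 : ℂ), (0 : ℝ)) = 0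
    simp
  smul_add g v w := by
    change (SU11.a g * (v.1 + w.1) + SU11.b g * conj (v.2.1 + w.2.1),
        SU11.a g * (v.2.1 + w.2.1) + SU11.b g * conj (v.1 + w.1), v.2.2 + w.2.2) =
      ((SU11.a g * v.1 + SU11.b g * conj v.2.1) + (SU11.a g * w.1 + SU11.b g * conj w.2.1),
        (SU11.a g * v.2.1 + SU11.b g * conj v.1) + (SU11.a g * w.2.1 + SU11.b g * conj w.1), v.2.2 + w.2.2)
    simp only [map_add, Prod.mk.injEq, and_true]
    constructor <;> ring

lemma SU11.smul_homCoords (g : SU11) (v : HomCoords) :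
    g • v = (SU11.a g * v.1 + SU11.b g * conj v.2.1, SU11.a g * v.2.1 + SU11.b g * conj v.1, v.2.2) := rfl

instance : SMulCommClass SU11 ℝ HomCoords where
  smul_comm g r v := by
    simp only [SU11.smul_homCoords, Prod.smul_fst, Prod.smul_snd, Complex.real_smul, map_mul,
      Complex.conj_ofReal, Prod.smul_mk, Prod.mk.injEq, and_true]
    constructor <;> ring

/-- The equation `|z₁|² - |z₂|² = t²`. -/
def OnQuadric (v : HomCoords) : Prop := ‖v.1‖ ^ 2 - ‖v.2.1‖ ^ 2 = v.2.2 ^ 2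

lemma onQuadric_smul_real (r : ℝ) (hr : r ≠ 0) (v : HomCoords) :
    OnQuadric (r • v) ↔ OnQuadric v := by
  simp only [OnQuadric, Prod.smul_fst, Prod.smul_snd, norm_smul, smul_eq_mul, mul_pow,
    Real.norm_eq_abs, sq_abs]
  rw [← mul_sub, mul_right_inj' (pow_ne_zero 2 hr)]

lemma onQuadric_smul (g : SU11) (v : HomCoords) : OnQuadric (g • v) ↔ OnQuadric v := by
  have h := SU11.normSq_sub g
  simp only [OnQuadric, SU11.smul_homCoords, ← Complex.normSq_eq_norm_sq]
  suffices hs : Complex.normSq (SU11.a g * v.1 + SU11.b g * conj v.2.1)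
      - Complex.normSq (SU11.a g * v.2.1 + SU11.b g * conj v.1)
      = Complex.normSq v.1 - Complex.normSq v.2.1 by rw [hs]
  simp only [Complex.normSq_apply, Complex.add_re, Complex.add_im, Complex.mul_re,
    Complex.mul_im, Complex.conj_re, Complex.conj_im] at h ⊢
  linear_combination
    (v.1.re * v.1.re + v.1.im * v.1.im - (v.2.1.re * v.2.1.re + v.2.1.im * v.2.1.im)) * h

/-- The quadric `{[z₁, z₂, t] : |z₁|² - |z₂|² = t²}` in `ℝP⁴`. -/
def quadric : Set RP4 :=
  {p | Projectivization.lift (fun v => OnQuadric v.1) (by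
    rintro ⟨v, hv⟩ ⟨w, hw⟩ t (rfl : v = t • w)
    have ht : t ≠ 0 := fun h => hv (by simp [h])
    simp [onQuadric_smul_real t ht]) p}

/-- The quadric as a topological space, with the topology induced from `ℝP⁴`. -/
abbrev Quadric : Type := quadric

lemma smul_mem_quadric (g : SU11) (p : RP4) (hp : p ∈ quadric) : g • p ∈ quadric := by
  revert hp
  refine Projectivization.ind (fun v hv => ?_) p
  exact fun hp => (onQuadric_smul g v).2 hp

instance : MulAction SU11 Quadric where
  smul g p := ⟨g • p.1, smul_mem_quadric g p.1 p.2⟩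
  one_smul p := Subtype.ext (one_smul SU11 p.1)
  mul_smul g h p := Subtype.ext (mul_smul g h p.1)

/-- The function `f (z, [α, β, t]) = (conj α z - β) / (-conj β z + α)`. -/
def discQuadricFun (z : Disc) (p : Quadric) : ℂ :=
  Projectivization.lift
    (fun v => (conj v.1.1 * (z : ℂ) - v.1.2.1) / (-conj v.1.2.1 * (z : ℂ) + v.1.1)) (by
      rintro ⟨v, hv⟩ ⟨w, hw⟩ t (rfl : v = t • w)
      have ht : (t : ℂ) ≠ 0 := by
        intro h
        apply hv
        simp [Complex.ofReal_eq_zero.1 h]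
      simp only [Prod.smul_fst, Prod.smul_snd, Complex.real_smul, map_mul, Complex.conj_ofReal]
      rw [← mul_div_mul_left _ (-conj w.2.1 * (z : ℂ) + w.1) ht]
      congr 1 <;> ring) p.1

/-! ## Real-analytic foliations by Riemann surfaces -/

section Foliation

variable (E : Type*) [NormedAddCommGroup E] [NormedSpace ℝ E]

/-- The real-analytic maps between open subsets of `ℂ × E` which have, locally, the form
`(z, x) ↦ (h (z, x), τ x)` with `h` holomorphic in `z`. -/
def holFoliationPregroupoid : Pregroupoid (ModelProd ℂ E) where
  property f s :=
    ContDiffOn ℝ ω (E := ℂ × E) (F := ℂ × E) f s ∧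
    ∀ p ∈ s, DifferentiableAt ℂ (fun w : ℂ => (f (w, p.2)).1) p.1 ∧
      ∀ᶠ w in 𝓝 p.1, (f (w, p.2)).2 = (f p).2
  comp := by
    intro f g u v hf hg hu hv huv
    refine ⟨ContDiffOn.comp (E := ℂ × E) (F := ℂ × E) (G := ℂ × E) (t := v) hg.1
      (hf.1.mono Set.inter_subset_left) (fun x hx => hx.2), ?_⟩
    intro p hp
    obtain ⟨hf1, hf2⟩ := hf.2 p hp.1
    obtain ⟨hg1, hg2⟩ := hg.2 (f p) hp.2
    have key : ∀ᶠ w in 𝓝 p.1, f (w, p.2) = ((f (w, p.2)).1, (f p).2) := by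
      filter_upwards [hf2] with w hw
      exact Prod.ext rfl hw
    constructor
    · have h := DifferentiableAt.comp (g := fun w : ℂ => (g (w, (f p).2)).1) p.1 hg1 hf1
      refine h.congr_of_eventuallyEq ?_
      filter_upwards [key] with w hw
      change (g (f (w, p.2))).1 = (g ((f (w, p.2)).1, (f p).2)).1
      rw [← hw]
    · have hc : Filter.Tendsto (fun w : ℂ => (f (w, p.2)).1) (𝓝 p.1) (𝓝 (f p).1) :=
        hf1.continuousAt
      filter_upwards [key, hc.eventually hg2] with w hw hw2
      change (g (f (w, p.2))).2 = (g (f p)).2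
      rw [hw]
      exact hw2
  id_mem := by
    refine ⟨contDiffOn_id, fun p _ => ⟨differentiableAt_id, Filter.Eventually.of_forall ?_⟩⟩
    intro w
    rfl
  locality := by
    intro f u hu h
    constructor
    · intro p hp
      obtain ⟨v, hv, hpv, h1, -⟩ := h p hp
      exact (h1 p ⟨hp, hpv⟩).mono_of_mem_nhdsWithin
        (Filter.inter_mem self_mem_nhdsWithin (mem_nhdsWithin_of_mem_nhds (hv.mem_nhds hpv)))
    · intro p hp
      obtain ⟨v, hv, hpv, -, h2⟩ := h p hp
      exact h2 p ⟨hp, hpv⟩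
  congr := by
    intro f g u hu hfg hf
    refine ⟨hf.1.congr hfg, fun p hp => ?_⟩
    obtain ⟨h1, h2⟩ := hf.2 p hp
    have hev : ∀ᶠ w : ℂ in 𝓝 p.1, ((w, p.2) : ModelProd ℂ E) ∈ u := by
      have hc : Continuous fun w : ℂ => ((w, p.2) : ℂ × E) := by fun_prop
      exact hc.continuousAt.preimage_mem_nhds (hu.mem_nhds hp)
    constructor
    · refine h1.congr_of_eventuallyEq ?_
      filter_upwards [hev] with w hw
      rw [hfg _ hw]
    · filter_upwards [hev, h2] with w hw hw2
      rw [hfg _ hw, hfg _ hp, hw2]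

/-- The pseudogroup of changes of foliated charts of real-analytic foliations by Riemann surfaces
whose transverse model is `E`. A real-analytic manifold `M` with a real-analytic foliation by
Riemann surfaces is a space with charts in `ℂ × E` and `HasGroupoid M (holFoliationGroupoid E)`;
in a foliated chart, the plaques are the sets on which the `E`-coordinate is constant. -/
def holFoliationGroupoid : StructureGroupoid (ModelProd ℂ E) :=
  (holFoliationPregroupoid E).groupoid

variable {M : Type*} [TopologicalSpace M] [ChartedSpace (ModelProd ℂ E) M]

/-- The leaf through `p`: the points that can be reached from `p` along a path which stays
locally in a plaque. -/
def leaf (p : M) : Set M :=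
  {q | ∃ γ : Path p q, ∀ t : unitInterval, ∀ᶠ s in 𝓝 t,
    (chartAt (ModelProd ℂ E) (γ t) (γ s)).2 = (chartAt (ModelProd ℂ E) (γ t) (γ t)).2}

/-- In every foliated chart, `F` is holomorphic in the leaf coordinate. -/
def LeafwiseHolomorphic (F : M → ℂ) : Prop :=
  ∀ e ∈ atlas (ModelProd ℂ E) M, ∀ p ∈ e.target,
    DifferentiableAt ℂ (fun w : ℂ => F (e.symm (w, p.2))) p.1

/-- `F` is constant on each leaf. -/
def LeafwiseConstant (F : M → ℂ) : Prop :=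
  ∀ p : M, ∀ q ∈ leaf E p, F q = F p

/-- Real-analyticity of complex valued functions on a foliated manifold. -/
def RealAnalytic (F : M → ℂ) : Prop :=
  ContMDiff (𝓘(ℝ, ℂ).prod 𝓘(ℝ, E)) 𝓘(ℝ, ℂ) ω F

variable (M) in
/-- A compact connected real-analytic manifold with a real-analytic foliation by Riemann
surfaces. -/
structure IsCompactAnalyticFoliation : Prop where
  t2 : T2Space M
  compact : CompactSpace M
  connected : ConnectedSpace M
  foliated : HasGroupoid M (holFoliationGroupoid E)

end Foliation

/-- A compact connected Riemann surface. -/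
structure IsCompactRiemannSurface (S : Type*) [TopologicalSpace S] [ChartedSpace ℂ S] :
    Prop where
  t2 : T2Space S
  compact : CompactSpace S
  connected : ConnectedSpace S
  complexManifold : IsManifold 𝓘(ℂ) ω S

/-- A compact real-analytic foliated bundle `M` over a compact Riemann surface `S`, where `T` is the
universal covering of `S`, the group `Γ` is the group of deck transformations of `T` over `S`,
the fibre `X` is a compact connected real-analytic manifold with an action of `Γ`, and
`M` is the quotient of `T × X` by the diagonal action of `Γ`, foliated by the images of
the sets `T × {x}`. -/
structure IsAnalyticFoliatedBundle
    (Γ : Type*) [Group Γ]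
    {T : Type*} [TopologicalSpace T] [ChartedSpace ℂ T] [MulAction Γ T]
    (E : Type*) [NormedAddCommGroup E] [NormedSpace ℝ E]
    {X : Type*} [TopologicalSpace X] [ChartedSpace E X] [MulAction Γ X]
    {S : Type*} [TopologicalSpace S] [ChartedSpace ℂ S]
    {M : Type*} [TopologicalSpace M] [ChartedSpace (ModelProd ℂ E) M]
    (projS : T → S) (projM : T × X → M) : Prop where
  base : IsCompactRiemannSurface S
  simplyConnected : SimplyConnectedSpace T
  covering : IsCoveringMap projS
  covering_holomorphic : IsLocalDiffeomorph 𝓘(ℂ) 𝓘(ℂ) ω projS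
  covering_surjective : Function.Surjective projS
  covering_orbits : ∀ z w : T, projS z = projS w ↔ ∃ γ : Γ, γ • z = w
  deck_continuous : ∀ γ : Γ, Continuous fun z : T => γ • z
  deck_free : ∀ (γ : Γ) (z : T), γ • z = z → γ = 1
  fibre_t2 : T2Space X
  fibre_compact : CompactSpace X
  fibre_connected : ConnectedSpace X
  fibre_manifold : IsManifold 𝓘(ℝ, E) ω X
  fibre_action : ∀ γ : Γ, ContMDiff 𝓘(ℝ, E) 𝓘(ℝ, E) ω fun x : X => γ • x
  total : IsCompactAnalyticFoliation E M
  total_quotient : Topology.IsQuotientMap projM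
  total_orbits : ∀ p q : T × X, projM p = projM q ↔ ∃ γ : Γ, γ • p = q
  /-- The foliated structure of `M` is induced by the product structure of `T × X`. -/
  total_local_iso :
    ChartedSpace.LiftProp (holFoliationGroupoid E).IsLocalStructomorphWithinAt projM
  leaf_eq : ∀ (z : T) (x : X), leaf E (projM (z, x)) = Set.range fun w : T => projM (w, x)
  /-- The natural projection of `M` to `S` is a fibre bundle with fibre `X`. -/
  bundle : ∃ proj : M → S, (∀ (z : T) (x : X), proj (projM (z, x)) = projS z) ∧
    ∀ s : S, ∃ e : Bundle.Trivialization X proj, s ∈ e.baseSet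

/-! ## The spaces of the example -/

/-- The quotient of the disc by a group `Γ`. -/
def DiscQuotient (Γ : Subgroup SU11) : Type := MulAction.orbitRel.Quotient Γ Disc

/-- The quotient of the product of the disc and the quadric by the diagonal action of `Γ`. -/
def BundleSpace (Γ : Subgroup SU11) : Type := MulAction.orbitRel.Quotient Γ (Disc × Quadric)

/-- The quotient map onto `DiscQuotient Γ`. -/
def DiscQuotient.mk (Γ : Subgroup SU11) (z : Disc) : DiscQuotient Γ :=
  Quotient.mk (MulAction.orbitRel Γ Disc) z

/-- The quotient map onto `BundleSpace Γ`. -/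
def BundleSpace.mk (Γ : Subgroup SU11) (p : Disc × Quadric) : BundleSpace Γ :=
  Quotient.mk (MulAction.orbitRel Γ (Disc × Quadric)) p

instance (Γ : Subgroup SU11) : TopologicalSpace (DiscQuotient Γ) :=
  TopologicalSpace.coinduced (DiscQuotient.mk Γ) inferInstance

instance (Γ : Subgroup SU11) : TopologicalSpace (BundleSpace Γ) :=
  TopologicalSpace.coinduced (BundleSpace.mk Γ) inferInstance

end

noncomputable section

/-! ## The topology of `SU(1,1)` -/

namespace SU11

/-! Where t ≠ 0, a point of the quadric scales to [α, β, 1], which is a matrix h of SU(1,1). The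
action on ℝP⁴ becomes left multiplication and f(z, h) = h⁻¹ z, so the invariance of f reads
(gh)⁻¹(gz) = h⁻¹ z. The quadric is a compactification of the group. The function extends to all of
it because |β| ≤ |α|, α ≠ 0 and |z| < 1 keep the denominator from vanishing
(`discQuadricFun_denom_ne`). On t = 0 the extension no longer depends on z, but over h = 1 it is z
itself, so it is not leafwise constant.

The rest is the suspension construction. If g moves a point of a compact part of the disc to another
such point, then |α| is bounded (`Disc.norm_a_mul_le`), and a discrete subgroup has only finitely
many such elements. Hence Γ acts properly discontinuously on the disc, and freely since stabilizers
are finite and Γ has no torsion. Both properties pass to the product with the quadric, so both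
quotient maps are coverings with group Γ. Charts downstairs are local sections followed by charts
upstairs; their changes are locally the elements of Γ written in charts
(`IsQuotientCoveringMap.transition_mem`), which are Möbius in z and independent of z in the
transverse coordinate. Leaves are found by path lifting.

The lattice is arithmetic. The matrices with entries in ℤ[i] and √3 ℤ[i] form an order in a
quaternion algebra whose norm form x₀² + x₁² - 3(x₂² + x₃²) has no non-trivial integral zero. For
any g, Minkowski's theorem gives an integral x ≠ 0 with gx bounded, so the norm of x is non-zero and
bounded. If c represents the class of x among finitely many congruence classes, then γ = x c⁻¹ lies
in the lattice and gγ = (gx) c⁻¹ is bounded, which is cocompactness. The congruence modulo 3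
excludes torsion. -/

lemma ext_ab {g h : SU11} (ha : a g = a h) (hb : b g = b h) : g = h := by
  apply Subtype.ext
  apply Subtype.ext
  ext i j
  fin_cases i <;> fin_cases j
  · exact ha
  · exact hb
  · change g.1.1 1 0 = h.1.1 1 0
    rw [g.2.1, h.2.1]
    exact congrArg conj hb
  · change g.1.1 1 1 = h.1.1 1 1
    rw [g.2.2, h.2.2]
    exact congrArg conj ha

/-- The element of `SU(1,1)` with entries `α` and `β`. -/
def ofEntries (α β : ℂ) (h : Complex.normSq α - Complex.normSq β = 1) : SU11 :=
  ⟨⟨!![α, β; conj β, conj α], by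
    rw [Matrix.det_fin_two_of, Complex.mul_conj, Complex.mul_conj]
    exact_mod_cast h⟩, rfl, rfl⟩

@[simp] lemma a_ofEntries (α β : ℂ) (h) : a (ofEntries α β h) = α := rfl

@[simp] lemma b_ofEntries (α β : ℂ) (h) : b (ofEntries α β h) = β := rfl

lemma continuous_coe : Continuous fun g : SU11 => g.1.1 := by
  exact continuous_subtype_val.comp continuous_subtype_val

lemma continuous_a : Continuous a := continuous_coe.matrix_elem 0 0

lemma continuous_b : Continuous b := continuous_coe.matrix_elem 0 1

lemma a_inv (g : SU11) : a g⁻¹ = conj (a g) := by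
  simp [a, Matrix.SpecialLinearGroup.coe_inv, Matrix.adjugate_fin_two, g.2.2]

lemma b_inv (g : SU11) : b g⁻¹ = -b g := by
  simp [b, Matrix.SpecialLinearGroup.coe_inv, Matrix.adjugate_fin_two]

/-- As a space, SU(1,1) is the closed real quadric |α|² - |β|² = 1 in ℂ². Compactness questions in
the group thereby reduce to a bound on |α|, which also bounds |β|. -/
lemma isClosedEmbedding_ab : Topology.IsClosedEmbedding fun g : SU11 => (a g, b g) := by
  have hc : Continuous fun g : SU11 => (a g, b g) := continuous_a.prodMk continuous_b
  have hF : Continuous fun p : ℂ × ℂ => !![p.1, p.2; conj p.2, conj p.1] := by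
    refine continuous_matrix fun i j => ?_
    fin_cases i <;> fin_cases j <;> simp <;> fun_prop
  refine ⟨⟨?_, fun g h hgh => ext_ab (congrArg Prod.fst hgh) (congrArg Prod.snd hgh)⟩, ?_⟩
  · refine .of_comp hc hF ?_
    have : ((fun p : ℂ × ℂ => !![p.1, p.2; conj p.2, conj p.1]) ∘ fun g : SU11 => (a g, b g))
        = fun g : SU11 => g.1.1 := by
      funext g
      ext i j
      fin_cases i <;> fin_cases j
      · rfl
      · rfl
      · exact g.2.1.symm
      · exact g.2.2.symm
    rw [this]
    exact Topology.IsInducing.subtypeVal.comp Topology.IsInducing.subtypeVal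
  · have : Set.range (fun g : SU11 => (a g, b g)) =
        {p : ℂ × ℂ | Complex.normSq p.1 - Complex.normSq p.2 = 1} := by
      ext p
      constructor
      · rintro ⟨g, rfl⟩
        exact normSq_sub g
      · intro hp
        exact ⟨ofEntries p.1 p.2 hp, by simp⟩
    rw [this]
    refine isClosed_eq ?_ continuous_const
    exact (Complex.continuous_normSq.comp continuous_fst).sub
      (Complex.continuous_normSq.comp continuous_snd)

lemma norm_b_le_norm_a (g : SU11) : ‖b g‖ ≤ ‖a g‖ := by
  have h := normSq_sub g
  rw [Complex.normSq_eq_norm_sq, Complex.normSq_eq_norm_sq] at h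
  nlinarith [norm_nonneg (a g), norm_nonneg (b g)]

lemma isCompact_norm_a_le (C : ℝ) : IsCompact {g : SU11 | ‖a g‖ ≤ C} := by
  have hK : IsCompact (Metric.closedBall (0 : ℂ) C ×ˢ Metric.closedBall (0 : ℂ) C) :=
    (isCompact_closedBall _ _).prod (isCompact_closedBall _ _)
  convert isClosedEmbedding_ab.isCompact_preimage hK using 1
  ext g
  have := norm_b_le_norm_a g
  simp only [Set.mem_ofPred_eq, Set.mem_preimage, Set.mem_prod, mem_closedBall_zero_iff]
  exact ⟨fun h => ⟨h, this.trans h⟩, fun h => h.1⟩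

lemma finite_norm_a_le (Γ : Subgroup SU11) [DiscreteTopology Γ] (C : ℝ) :
    {γ : Γ | ‖a γ‖ ≤ C}.Finite := by
  have hΓ : IsClosed (Γ : Set SU11) := Subgroup.isClosed_of_discrete
  have hc : IsCompact (Subtype.val ⁻¹' {g : SU11 | ‖a g‖ ≤ C} : Set Γ) :=
    hΓ.isClosedEmbedding_subtypeVal.isCompact_preimage (isCompact_norm_a_le C)
  exact hc.finite_of_discrete

end SU11

/-! ## The action on the disc -/

namespace Disc

lemma coe_smul (g : SU11) (z : Disc) : ((g • z : Disc) : ℂ) =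
    (SU11.a g * (z : ℂ) + SU11.b g) / (conj (SU11.b g) * (z : ℂ) + conj (SU11.a g)) := rfl

instance : ContinuousSMul SU11 Disc where
  continuous_smul := by
    refine Continuous.subtype_mk ?_ _
    have ha : Continuous fun p : SU11 × Disc => SU11.a p.1 := SU11.continuous_a.comp continuous_fst
    have hb : Continuous fun p : SU11 × Disc => SU11.b p.1 := SU11.continuous_b.comp continuous_fst
    have hz : Continuous fun p : SU11 × Disc => (p.2 : ℂ) :=
      continuous_subtype_val.comp continuous_snd
    exact ((ha.mul hz).add hb).div
      (((Complex.continuous_conj.comp hb).mul hz).add (Complex.continuous_conj.comp ha))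
      fun p => denom_ne p.1 p.2

lemma norm_lt_one (z : Disc) : ‖(z : ℂ)‖ < 1 := by simpa [Disc] using z.2

/-- Let D be the denominator of gz. From |D|² - |αz + β|² = 1 - |z|² and |gz| ≤ r follows |D|² (1 -
r²) ≤ 1, while |D| ≥ |α| - |β||z| ≥ |α|(1 - r). -/
lemma norm_a_mul_le (g : SU11) (z : Disc) {r : ℝ} (hr : r < 1) (hz : ‖(z : ℂ)‖ ≤ r)
    (hgz : ‖((g • z : Disc) : ℂ)‖ ≤ r) : (‖SU11.a g‖ * (1 - r)) ^ 2 * (1 - r ^ 2) ≤ 1 := by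
  have h0 : 0 ≤ r := (norm_nonneg _).trans hz
  have h := normSq_identity g z
  have hd := denom_ne g z
  rw [coe_smul, norm_div] at hgz
  set D := conj (SU11.b g) * (z : ℂ) + conj (SU11.a g) with hD
  have hDp : 0 < ‖D‖ := norm_pos_iff.2 hd
  rw [div_le_iff₀ hDp] at hgz
  rw [Complex.normSq_eq_norm_sq, Complex.normSq_eq_norm_sq, Complex.normSq_eq_norm_sq] at h
  have h1 : ‖D‖ ^ 2 * (1 - r ^ 2) ≤ 1 := by
    nlinarith [norm_nonneg (SU11.a g * (z : ℂ) + SU11.b g), norm_nonneg (z : ℂ), mul_nonneg h0 hDp.le]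
  have h2 : ‖SU11.a g‖ * (1 - r) ≤ ‖D‖ := by
    have e : conj (SU11.a g) = D - conj (SU11.b g) * (z : ℂ) := by rw [hD]; ring
    have e2 : ‖SU11.a g‖ ≤ ‖D‖ + ‖SU11.b g‖ * ‖(z : ℂ)‖ := by
      rw [← Complex.norm_conj (SU11.a g), e]
      refine (norm_sub_le _ _).trans ?_
      rw [norm_mul, Complex.norm_conj]
    nlinarith [SU11.norm_b_le_norm_a g, norm_nonneg (SU11.b g), norm_nonneg (SU11.a g), norm_nonneg (z : ℂ),
      mul_le_mul (SU11.norm_b_le_norm_a g) hz (norm_nonneg _) (norm_nonneg _)]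
  refine le_trans ?_ h1
  have : 0 ≤ 1 - r ^ 2 := by nlinarith
  gcongr

lemma exists_norm_le_of_isCompact {K : Set Disc} (hK : IsCompact K) :
    ∃ r < 1, 0 ≤ r ∧ ∀ z ∈ K, ‖(z : ℂ)‖ ≤ r := by
  rcases K.eq_empty_or_nonempty with rfl | hne
  · exact ⟨0, by simp⟩
  obtain ⟨z, -, hz⟩ := hK.exists_isMaxOn hne continuous_subtype_val.norm.continuousOn
  exact ⟨‖(z : ℂ)‖, norm_lt_one z, norm_nonneg _, hz⟩

lemma finite_smul_mem (Γ : Subgroup SU11) [DiscreteTopology Γ] {K L : Set Disc}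
    (hK : IsCompact K) (hL : IsCompact L) : {γ : Γ | ∃ z ∈ K, γ • z ∈ L}.Finite := by
  obtain ⟨r, hr1, hr0, hr⟩ := exists_norm_le_of_isCompact (hK.union hL)
  have hd : 0 < (1 - r) ^ 2 * (1 - r ^ 2) := by
    have : 0 < 1 - r := by linarith
    have : 0 < 1 - r ^ 2 := by nlinarith
    positivity
  -- The estimate bounds |α|², and x ≤ 1 + x² turns this into a bound on |α| without a square root.
  refine (SU11.finite_norm_a_le Γ (1 + 1 / ((1 - r) ^ 2 * (1 - r ^ 2)))).subset ?_
  rintro γ ⟨z, hz, hγz⟩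
  have h := norm_a_mul_le γ.1 z hr1 (hr z (.inl hz)) (hr _ (.inr hγz))
  rw [mul_pow, mul_assoc, ← le_div_iff₀ hd] at h
  change ‖SU11.a γ‖ ≤ _
  nlinarith [norm_nonneg (SU11.a (γ : SU11))]

/-- The powers of γ all fix z, and only finitely many elements of Γ do, so γ has finite order. -/
lemma smul_eq_self (Γ : Subgroup SU11) (hΓ : IsTorsionFreeUniformLattice Γ) (γ : Γ) (z : Disc)
    (h : γ • z = z) : γ = 1 := by
  have := hΓ.discrete
  have hfin := finite_smul_mem Γ (isCompact_singleton (x := z)) (isCompact_singleton (x := z))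
  have hp : IsOfFinOrder γ := by
    by_contra hno
    have hinj : Function.Injective fun n : ℕ => γ ^ n := injective_pow_iff_not_isOfFinOrder.2 hno
    refine Set.infinite_of_injective_forall_mem hinj (fun n => ?_) hfin
    refine ⟨z, rfl, ?_⟩
    induction n with
    | zero => simp
    | succ k ih =>
      simp only [Set.mem_singleton_iff] at ih ⊢
      rw [pow_succ, mul_smul, h, ih]
  exact Subtype.ext (hΓ.torsionFree γ γ.2 (Submonoid.isOfFinOrder_coe.2 hp))

end Disc

/-! ## A torsion-free uniform lattice -/

namespace SU11

/-- By Cayley–Hamilton g² = 2 Re(α) g - 1, so every power is u g - v with real u, v. If |Re α| ≥ 1,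
the recursion (u, v) ↦ (2 Re(α) u - v, u) preserves |u| ≥ |v| + 1. In particular u never vanishes,
so a power can be 1 only if g is real scalar. -/
lemma exists_pow_eq (g : SU11) (hg : 1 ≤ |(a g).re|) (n : ℕ) : ∃ u v : ℝ, |v| + 1 ≤ |u| ∧
    a (g ^ (n + 1)) = u * a g - v ∧ b (g ^ (n + 1)) = u * b g := by
  induction n with
  | zero => exact ⟨1, 0, by simp⟩
  | succ n ih =>
    obtain ⟨u, v, huv, hA, hB⟩ := ih
    refine ⟨u * (2 * (a g).re) - v, u, ?_, ?_, ?_⟩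
    · have h1 : |u * (2 * (a g).re)| - |v| ≤ |u * (2 * (a g).re) - v| := abs_sub_abs_le_abs_sub _ _
      rw [abs_mul, abs_mul, abs_two] at h1
      nlinarith [abs_nonneg u, mul_le_mul_of_nonneg_left hg (abs_nonneg u)]
    · have h := normSq_sub g
      have h' : a g * conj (a g) - b g * conj (b g) = 1 := by
        rw [Complex.mul_conj, Complex.mul_conj]
        exact_mod_cast h
      have ht : ((2 * (a g).re : ℝ) : ℂ) = a g + conj (a g) := (Complex.add_conj _).symm
      rw [pow_succ, a_mul, hA, hB, Complex.ofReal_sub, Complex.ofReal_mul, ht]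
      linear_combination (-(u : ℂ)) * h'
    · have ht : ((2 * (a g).re : ℝ) : ℂ) = a g + conj (a g) := (Complex.add_conj _).symm
      rw [pow_succ, b_mul, hA, hB, Complex.ofReal_sub, Complex.ofReal_mul, ht]
      ring

/-- An element of finite order which is not elliptic is central. -/
lemma b_eq_zero_of_isOfFinOrder {g : SU11} (hg : 1 ≤ |(a g).re|) (hfin : IsOfFinOrder g) :
    b g = 0 ∧ (a g).im = 0 := by
  obtain ⟨n, hn, hpow⟩ := isOfFinOrder_iff_pow_eq_one.1 hfin
  obtain ⟨k, rfl⟩ := Nat.exists_eq_succ_of_ne_zero hn.ne'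
  obtain ⟨u, v, huv, hA, hB⟩ := exists_pow_eq g hg k
  have hu : u ≠ 0 := by
    rintro rfl
    rw [abs_zero] at huv
    linarith [abs_nonneg v]
  rw [Nat.succ_eq_add_one] at hpow
  rw [hpow, b_one] at hB
  rw [hpow, a_one] at hA
  constructor
  · simpa [hu] using hB.symm
  · have := congrArg Complex.im hA
    simpa [hu] using this.symm

/-! ### The congruence subgroup: no torsion, discreteness -/

lemma sqrt_three_sq : √3 ^ 2 = (3 : ℝ) := Real.sq_sqrt (by norm_num)

/-- The matrices with `α ∈ 1 + 3ℤ[i]` and `β ∈ √3 ℤ[i]`. -/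
def congruenceLattice : Subgroup SU11 where
  carrier := {g | ∃ p q r s : ℤ, a g = ⟨1 + 3 * p, 3 * q⟩ ∧ b g = ⟨√3 * r, √3 * s⟩}
  one_mem' := ⟨0, 0, 0, 0, by rw [a_one]; apply Complex.ext <;> simp,
    by rw [b_one]; apply Complex.ext <;> simp⟩
  mul_mem' := by
    rintro g h ⟨p, q, r, s, hga, hgb⟩ ⟨p', q', r', s', hha, hhb⟩
    have h3 := sqrt_three_sq
    -- The product of two elements of √3 ℤ[i] lies in 3 ℤ[i]; hence α stays congruent to 1 modulo 3
    -- although β is subject to no congruence.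
    refine ⟨p + p' + 3 * p * p' - 3 * q * q' + r * r' + s * s',
      q + q' + 3 * p * q' + 3 * q * p' + s * r' - r * s',
      r' + 3 * p * r' - 3 * q * s' + r + 3 * r * p' + 3 * s * q',
      s' + 3 * p * s' + 3 * q * r' + s + 3 * s * p' - 3 * r * q', ?_, ?_⟩
    · rw [a_mul, hga, hgb, hha, hhb]
      apply Complex.ext
      · simp
        linear_combination (r * r' + s * s' : ℝ) * h3
      · simp
        linear_combination (s * r' - r * s' : ℝ) * h3
    · rw [b_mul, hga, hgb, hha, hhb]
      apply Complex.ext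
      · simp
        ring
      · simp
        ring
  inv_mem' := by
    rintro g ⟨p, q, r, s, hga, hgb⟩
    refine ⟨p, -q, -r, -s, ?_, ?_⟩
    · rw [a_inv, hga]
      apply Complex.ext <;> simp
    · rw [b_inv, hgb]
      apply Complex.ext <;> simp

/-- Re α = 1 + 3p is a non-zero integer, so the element is not elliptic. Finite order then forces β
= 0 and α = ±1, and α = -1 is not congruent to 1 modulo 3. -/
lemma congruenceLattice_torsionFree (g : SU11) (hg : g ∈ congruenceLattice)
    (hfin : IsOfFinOrder g) : g = 1 := by
  obtain ⟨p, q, r, s, ha, hb⟩ := hg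
  have hre : 1 ≤ |(a g).re| := by
    rw [ha]
    have : (1 : ℤ) ≤ |1 + 3 * p| := Int.one_le_abs (by omega)
    change (1 : ℝ) ≤ |1 + 3 * (p : ℝ)|
    exact_mod_cast this
  obtain ⟨hb0, him⟩ := b_eq_zero_of_isOfFinOrder hre hfin
  have h := normSq_sub g
  rw [hb0, map_zero, sub_zero, Complex.normSq_apply, him, mul_zero, add_zero, ha] at h
  have h' : (1 + 3 * p) * (1 + 3 * p) = 1 := by
    have h2 : ((1 : ℝ) + 3 * p) * (1 + 3 * p) = 1 := h
    exact_mod_cast h2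
  have hp : p = 0 := by
    rcases Int.mul_eq_one_iff_eq_one_or_neg_one.1 h' with h | h <;> omega
  refine ext_ab ?_ (hb0.trans b_one.symm)
  rw [a_one]
  apply Complex.ext
  · simp [ha, hp]
  · simpa using him

lemma congruenceLattice_discrete : DiscreteTopology congruenceLattice := by
  rw [discreteTopology_iff_isOpen_singleton_one]
  have hc : Continuous fun g : congruenceLattice => (a g.1, b g.1) :=
    (continuous_a.comp continuous_subtype_val).prodMk (continuous_b.comp continuous_subtype_val)
  -- The real coordinates of α - 1 and β are integer multiples of 3 and √3. Both spacings are at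
  -- least 1, so the unit ball isolates the identity.
  have ho : IsOpen (Metric.ball ((1 : ℂ), (0 : ℂ)) 1) := Metric.isOpen_ball
  convert ho.preimage hc
  ext ⟨g, hg⟩
  simp only [Set.mem_singleton_iff, Set.mem_preimage]
  constructor
  · intro h
    have hg1 : g = 1 := congrArg Subtype.val h
    simp [hg1, a_one, b_one]
  · intro h
    obtain ⟨p, q, r, s, ha, hb⟩ := hg
    rw [mem_ball_iff_norm, Prod.norm_def, max_lt_iff] at h
    obtain ⟨h1, h2⟩ := h
    have hr1 := (Complex.abs_re_le_norm _).trans_lt h1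
    have hi1 := (Complex.abs_im_le_norm _).trans_lt h1
    have hr2 := (Complex.abs_re_le_norm _).trans_lt h2
    have hi2 := (Complex.abs_im_le_norm _).trans_lt h2
    simp only [ha, hb, Prod.fst_sub, Prod.snd_sub, Complex.sub_re, Complex.sub_im, Complex.one_re,
      Complex.one_im, sub_zero, add_sub_cancel_left, abs_mul]
      at hr1 hi1 hr2 hi2
    have hs : (1 : ℝ) ≤ |√3| := by
      rw [abs_of_nonneg (Real.sqrt_nonneg _)]
      exact Real.one_le_sqrt.2 (by norm_num)
    have h3 : (1 : ℝ) ≤ |(3 : ℝ)| := by norm_num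
    have key : ∀ (c : ℝ) (n : ℤ), 1 ≤ |c| → |c| * |(n : ℝ)| < 1 → n = 0 := by
      intro c n hc h
      rw [← Int.abs_lt_one_iff]
      have : |(n : ℝ)| < 1 := by nlinarith [abs_nonneg (n : ℝ)]
      exact_mod_cast this
    refine Subtype.ext (ext_ab ?_ ?_)
    · change a g = a 1
      rw [ha, a_one, key _ _ h3 hr1, key _ _ h3 hi1]
      apply Complex.ext <;> simp
    · change b g = b 1
      rw [hb, b_one, key _ _ hs hr2, key _ _ hs hi2]
      apply Complex.ext <;> simp

/-! ### The quaternion norm form and cocompactness -/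

/-- The form `x₀² + x₁² - 3 x₂² - 3 x₃²`. -/
def quatNorm (x : Fin 4 → ℤ) : ℤ := x 0 ^ 2 + x 1 ^ 2 - 3 * (x 2 ^ 2 + x 3 ^ 2)

/-- -1 is not a square modulo 3. -/
lemma three_dvd_of_sq_add_sq {u v : ℤ} (h : 3 ∣ u ^ 2 + v ^ 2) : 3 ∣ u ∧ 3 ∣ v := by
  have hu : u % 3 = 0 ∨ u % 3 = 1 ∨ u % 3 = 2 := by omega
  have hv : v % 3 = 0 ∨ v % 3 = 1 ∨ v % 3 = 2 := by omega
  rw [Int.dvd_iff_emod_eq_zero] at h ⊢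
  rw [Int.dvd_iff_emod_eq_zero]
  rcases hu with hu | hu | hu <;> rcases hv with hv | hv | hv <;>
    simp [pow_two, Int.add_emod, Int.mul_emod, hu, hv] at h ⊢

/-- Infinite descent: 3 divides x₀ and x₁, hence also x₂ and x₃, and dividing all coordinates by 3
gives a smaller zero. The quaternion algebra is therefore a division algebra, which is the source of
cocompactness. -/
lemma quatNorm_eq_zero {x : Fin 4 → ℤ} (hx : quatNorm x = 0) : x = 0 := by
  have main : ∀ (n : ℕ) (x : Fin 4 → ℤ), quatNorm x = 0 →
      (x 0 ^ 2 + x 1 ^ 2).natAbs ≤ n → x 0 ^ 2 + x 1 ^ 2 = 0 := by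
    intro n
    induction n with
    | zero => intro x _ h; omega
    | succ n ih =>
      intro x hx hn
      unfold quatNorm at hx
      obtain ⟨⟨u, hu⟩, ⟨v, hv⟩⟩ := three_dvd_of_sq_add_sq
        (u := x 0) (v := x 1) ⟨x 2 ^ 2 + x 3 ^ 2, by linarith⟩
      obtain ⟨⟨w, hw⟩, ⟨t, ht⟩⟩ := three_dvd_of_sq_add_sq
        (u := x 2) (v := x 3) ⟨u ^ 2 + v ^ 2, by rw [hu, hv] at hx; linarith⟩
      rw [hu, hv, hw, ht] at hx
      have h0 := ih ![u, v, w, t] (by simp [quatNorm]; linarith) (by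
        have e : x 0 ^ 2 + x 1 ^ 2 = 9 * (u ^ 2 + v ^ 2) := by rw [hu, hv]; ring
        have := add_nonneg (sq_nonneg u) (sq_nonneg v)
        simp
        omega)
      simp at h0
      rw [hu, hv]
      linarith
  have h01 := main _ x hx le_rfl
  have h23 : x 2 ^ 2 + x 3 ^ 2 = 0 := by unfold quatNorm at hx; linarith
  have h0 : x 0 = 0 := by nlinarith [sq_nonneg (x 0), sq_nonneg (x 1)]
  have h1 : x 1 = 0 := by nlinarith [sq_nonneg (x 0), sq_nonneg (x 1)]
  have h2 : x 2 = 0 := by nlinarith [sq_nonneg (x 2), sq_nonneg (x 3)]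
  have h3 : x 3 = 0 := by nlinarith [sq_nonneg (x 2), sq_nonneg (x 3)]
  funext i
  fin_cases i <;> assumption

/-- The element `x₀ + x₁ i` of `ℤ[i]`. -/
def quatFst (x : Fin 4 → ℤ) : ℂ := ⟨x 0, x 1⟩

/-- The element `√3 (x₂ + x₃ i)` of `√3 ℤ[i]`. -/
def quatSnd (x : Fin 4 → ℤ) : ℂ := ⟨√3 * x 2, √3 * x 3⟩

lemma normSq_quat (x : Fin 4 → ℤ) :
    Complex.normSq (quatFst x) - Complex.normSq (quatSnd x) = quatNorm x := by
  have h3 := sqrt_three_sq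
  simp only [Complex.normSq_apply, quatFst, quatSnd, quatNorm]
  push_cast
  linear_combination (-(x 2 : ℝ) ^ 2 - (x 3 : ℝ) ^ 2) * h3

/-- The element is γ = x c⁻¹ in the quaternion algebra; the two formulas are its entries multiplied
by the norm m of c. Equal norms make its determinant 1, and the congruence modulo 3m makes it
integral and congruent to 1 modulo 3. -/
lemma exists_mem_congruenceLattice {x c : Fin 4 → ℤ} (hx : quatNorm x = quatNorm c)
    (hc : quatNorm c ≠ 0) (hxc : ∀ i, 3 * quatNorm c ∣ x i - c i) :
    ∃ γ ∈ congruenceLattice,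
      quatNorm c * a γ = quatFst x * conj (quatFst c) - quatSnd x * conj (quatSnd c) ∧
      quatNorm c * b γ = quatSnd x * quatFst c - quatFst x * quatSnd c := by
  choose w hw using hxc
  have hw' : ∀ i, x i = c i + 3 * quatNorm c * w i := fun i => by linarith [hw i]
  have h3 := sqrt_three_sq
  set m := quatNorm c with hm
  -- With x = c + 3mw one has x c⁻¹ = 1 + 3 w c̄, where c̄ is the quaternion conjugate; p, q, r/3,
  -- s/3 are the coordinates of w c̄.
  set p := w 0 * c 0 + w 1 * c 1 - 3 * (w 2 * c 2 + w 3 * c 3) with hp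
  set q := w 1 * c 0 - w 0 * c 1 - 3 * (w 3 * c 2 - w 2 * c 3) with hq
  set r := 3 * (w 2 * c 0 - w 3 * c 1 - w 0 * c 2 + w 1 * c 3) with hr
  set s := 3 * (w 2 * c 1 + w 3 * c 0 - w 0 * c 3 - w 1 * c 2) with hs
  have e1 : m * (1 + 3 * p) = x 0 * c 0 + x 1 * c 1 - 3 * (x 2 * c 2 + x 3 * c 3) := by
    rw [hw' 0, hw' 1, hw' 2, hw' 3, hp]
    have : m = c 0 ^ 2 + c 1 ^ 2 - 3 * (c 2 ^ 2 + c 3 ^ 2) := hm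
    linear_combination this
  have e2 : m * (3 * q) = x 1 * c 0 - x 0 * c 1 - 3 * (x 3 * c 2 - x 2 * c 3) := by
    rw [hw' 0, hw' 1, hw' 2, hw' 3, hq]
    ring
  have e3 : m * r = x 2 * c 0 - x 3 * c 1 - x 0 * c 2 + x 1 * c 3 := by
    rw [hw' 0, hw' 1, hw' 2, hw' 3, hr]
    ring
  have e4 : m * s = x 2 * c 1 + x 3 * c 0 - x 0 * c 3 - x 1 * c 2 := by
    rw [hw' 0, hw' 1, hw' 2, hw' 3, hs]
    ring
  have hdet : (1 + 3 * p) ^ 2 + (3 * q) ^ 2 - 3 * (r ^ 2 + s ^ 2) = 1 := by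
    have hmm : m ^ 2 * ((1 + 3 * p) ^ 2 + (3 * q) ^ 2 - 3 * (r ^ 2 + s ^ 2)) = m ^ 2 * 1 := by
      calc _ = (m * (1 + 3 * p)) ^ 2 + (m * (3 * q)) ^ 2 - 3 * ((m * r) ^ 2 + (m * s) ^ 2) := by ring
        _ = quatNorm x * quatNorm c := by
          rw [e1, e2, e3, e4]
          unfold quatNorm
          ring
        _ = m ^ 2 * 1 := by rw [hx]; ring
    exact mul_left_cancel₀ (pow_ne_zero 2 hc) hmm
  have hdet' : Complex.normSq ⟨1 + 3 * p, 3 * q⟩ - Complex.normSq ⟨√3 * r, √3 * s⟩ = 1 := by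
    have hd : (1 + 3 * (p : ℝ)) ^ 2 + (3 * (q : ℝ)) ^ 2 - 3 * ((r : ℝ) ^ 2 + (s : ℝ) ^ 2) = 1 := by
      exact_mod_cast hdet
    simp only [Complex.normSq_apply]
    linear_combination hd - ((r : ℝ) ^ 2 + (s : ℝ) ^ 2) * h3
  have f1 : (m : ℝ) * (1 + 3 * p) = x 0 * c 0 + x 1 * c 1 - 3 * (x 2 * c 2 + x 3 * c 3) := by
    exact_mod_cast e1
  have f2 : (m : ℝ) * (3 * q) = x 1 * c 0 - x 0 * c 1 - 3 * (x 3 * c 2 - x 2 * c 3) := by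
    exact_mod_cast e2
  have f3 : (m : ℝ) * r = x 2 * c 0 - x 3 * c 1 - x 0 * c 2 + x 1 * c 3 := by exact_mod_cast e3
  have f4 : (m : ℝ) * s = x 2 * c 1 + x 3 * c 0 - x 0 * c 3 - x 1 * c 2 := by exact_mod_cast e4
  refine ⟨ofEntries _ _ hdet', ⟨p, q, r, s, rfl, rfl⟩, ?_, ?_⟩
  · rw [a_ofEntries]
    clear_value p q r s m
    apply Complex.ext
    · simp [quatFst, quatSnd]
      linear_combination f1 + (x 2 * c 2 + x 3 * c 3 : ℝ) * h3
    · simp [quatFst, quatSnd]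
      linear_combination f2 + (x 3 * c 2 - x 2 * c 3 : ℝ) * h3
  · rw [b_ofEntries]
    clear_value p q r s m
    apply Complex.ext
    · simp [quatFst, quatSnd]
      linear_combination √3 * f3
    · simp [quatFst, quatSnd]
      linear_combination √3 * f4

lemma normSq_smul_sub (g : SU11) (z w : ℂ) :
    Complex.normSq (a g * z + b g * conj w) - Complex.normSq (a g * w + b g * conj z) =
      Complex.normSq z - Complex.normSq w := by
  have h := normSq_sub g
  simp only [Complex.normSq_apply, Complex.add_re, Complex.add_im, Complex.mul_re,
    Complex.mul_im, Complex.conj_re, Complex.conj_im] at h ⊢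
  linear_combination (z.re * z.re + z.im * z.im - (w.re * w.re + w.im * w.im)) * h

/-- Left multiplication by `g` in the quaternion algebra, in real coordinates. -/
def quatMatrix (g : SU11) : Matrix (Fin 4) (Fin 4) ℝ :=
  !![(a g).re, -(a g).im, √3 * (b g).re, √3 * (b g).im;
    (a g).im, (a g).re, √3 * (b g).im, -(√3 * (b g).re);
    (b g).re, (b g).im, √3 * (a g).re, -(√3 * (a g).im);
    (b g).im, -(b g).re, √3 * (a g).im, √3 * (a g).re]

/-- Left multiplication by g has determinant (|α|² - |β|²)² = 1; the factor 3 comes from the two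
coordinates scaled by √3. -/
lemma det_quatMatrix (g : SU11) : (quatMatrix g).det = 3 := by
  have h := normSq_sub g
  have h3 := sqrt_three_sq
  rw [Complex.normSq_apply, Complex.normSq_apply] at h
  simp [quatMatrix, Matrix.det_succ_row_zero, Fin.sum_univ_succ, Fin.succAbove]
  linear_combination ((a g).re ^ 2 + (a g).im ^ 2 - (b g).re ^ 2 - (b g).im ^ 2) ^ 2 * h3 +
    3 * ((a g).re ^ 2 + (a g).im ^ 2 - (b g).re ^ 2 - (b g).im ^ 2 + 1) * h

lemma quatMatrix_mulVec (g : SU11) (x : Fin 4 → ℤ) :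
    (quatMatrix g).mulVec (fun i => (x i : ℝ)) =
      ![(a g * quatFst x + b g * conj (quatSnd x)).re,
        (a g * quatFst x + b g * conj (quatSnd x)).im,
        (a g * quatSnd x + b g * conj (quatFst x)).re,
        (a g * quatSnd x + b g * conj (quatFst x)).im] := by
  funext i
  fin_cases i <;>
    simp [quatMatrix, Matrix.mulVec, dotProduct, Fin.sum_univ_succ, quatFst, quatSnd] <;> ring

open MeasureTheory in
/-- Minkowski's theorem for the linear images of the integral lattice. -/
lemma exists_mulVec_mem_closedBall {M : Matrix (Fin 4) (Fin 4) ℝ} (hM : M.det = 3) :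
    ∃ x : Fin 4 → ℤ, x ≠ 0 ∧ ∀ i, |(M.mulVec fun j => (x j : ℝ)) i| ≤ 2 := by
  have hM0 : LinearMap.det (Matrix.toLin' M) ≠ 0 := by
    rw [LinearMap.det_toLin', hM]
    norm_num
  set S : Set (Fin 4 → ℝ) := Matrix.toLin' M ⁻¹' Metric.closedBall 0 2 with hS
  -- The cube of side 4 has volume 256, and 256/3 exceeds the threshold 2⁴ of Minkowski's theorem
  -- for the lattice ℤ⁴.
  have hvol : volume S = ENNReal.ofReal (256 / 3) := by
    rw [hS, Measure.addHaar_preimage_linearMap _ hM0, LinearMap.det_toLin', hM,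
      Real.volume_pi_closedBall _ (by norm_num), ← ENNReal.ofReal_mul (by positivity)]
    congr 1
    rw [abs_of_pos (by norm_num)]
    norm_num
  have hfund := ZSpan.isAddFundamentalDomain' (Pi.basisFun ℝ (Fin 4)) volume
  have hone : volume (ZSpan.fundamentalDomain (Pi.basisFun ℝ (Fin 4))) = 1 := by
    rw [ZSpan.fundamentalDomain_pi_basisFun, volume_pi, Measure.pi_pi]
    simp
  have hcount : Countable (Submodule.span ℤ (Set.range (Pi.basisFun ℝ (Fin 4)))).toAddSubgroup := by
    change Countable (Submodule.span ℤ (Set.range (Pi.basisFun ℝ (Fin 4))))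
    infer_instance
  obtain ⟨⟨v, hv⟩, hv0, hvS⟩ := exists_ne_zero_mem_lattice_of_measure_mul_two_pow_lt_measure
    (s := S) hfund (fun x hx => by
      rw [hS, Set.mem_preimage, mem_closedBall_zero_iff] at hx ⊢
      rwa [map_neg, norm_neg])
    ((convex_closedBall (0 : Fin 4 → ℝ) 2).linear_preimage _) (by
      rw [hone, hvol, Module.finrank_fin_fun, one_mul]
      rw [show (2 : ENNReal) ^ 4 = ENNReal.ofReal 16 by
        rw [← ENNReal.ofReal_ofNat, ← ENNReal.ofReal_pow (by norm_num)]; norm_num]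
      rw [ENNReal.ofReal_lt_ofReal_iff (by norm_num)]
      norm_num)
  have hv' : v ∈ Submodule.span ℤ (Set.range (Pi.basisFun ℝ (Fin 4))) := hv
  rw [Module.Basis.mem_span_iff_repr_mem] at hv'
  choose x hx using hv'
  have hxv : (fun i => (x i : ℝ)) = v := by
    funext i
    simpa using hx i
  refine ⟨x, ?_, ?_⟩
  · rintro rfl
    apply hv0
    apply Subtype.ext
    simp [← hxv]
    rfl
  · rw [hxv]
    rw [hS, Set.mem_preimage, mem_closedBall_zero_iff, pi_norm_le_iff_of_nonneg (by norm_num)] at hvS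
    exact hvS

lemma exists_quat_bounded (g : SU11) : ∃ x : Fin 4 → ℤ, x ≠ 0 ∧
    ‖a g * quatFst x + b g * conj (quatSnd x)‖ ^ 2 ≤ 8 ∧
    ‖a g * quatSnd x + b g * conj (quatFst x)‖ ^ 2 ≤ 8 := by
  obtain ⟨x, hx0, hx⟩ := exists_mulVec_mem_closedBall (det_quatMatrix g)
  rw [quatMatrix_mulVec] at hx
  have key : ∀ z : ℂ, |z.re| ≤ 2 → |z.im| ≤ 2 → ‖z‖ ^ 2 ≤ 8 := by
    intro z h1 h2
    rw [← Complex.normSq_eq_norm_sq, Complex.normSq_apply]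
    nlinarith [abs_mul_abs_self z.re, abs_mul_abs_self z.im, abs_nonneg z.re, abs_nonneg z.im]
  exact ⟨x, hx0, key _ (hx 0) (hx 1), key _ (hx 2) (hx 3)⟩

/-- Left multiplication by g preserves the norm, so the norm of x is a difference of two numbers in
[0, 8]. -/
lemma abs_quatNorm_le (g : SU11) (x : Fin 4 → ℤ)
    (h1 : ‖a g * quatFst x + b g * conj (quatSnd x)‖ ^ 2 ≤ 8)
    (h2 : ‖a g * quatSnd x + b g * conj (quatFst x)‖ ^ 2 ≤ 8) : |quatNorm x| ≤ 8 := by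
  have h := (normSq_smul_sub g (quatFst x) (quatSnd x)).trans (normSq_quat x)
  rw [Complex.normSq_eq_norm_sq, Complex.normSq_eq_norm_sq] at h
  have : |(quatNorm x : ℝ)| ≤ 8 := by
    rw [← h, abs_le]
    constructor <;> nlinarith [sq_nonneg ‖a g * quatFst x + b g * conj (quatSnd x)‖,
      sq_nonneg ‖a g * quatSnd x + b g * conj (quatFst x)‖]
  exact_mod_cast this

/-- Choose x with gx bounded, replace it by a representative c with the same norm and residues, and
put γ = x c⁻¹. Only finitely many c occur, so (gx) c⁻¹ is bounded uniformly in g. -/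
lemma exists_norm_a_mul_le : ∃ C : ℝ, ∀ g : SU11, ∃ γ ∈ congruenceLattice, ‖a (g * γ)‖ ≤ C := by
  -- 2520 = 3 · lcm(1, …, 8), so 3m divides it for every norm m with 0 < |m| ≤ 8.
  let cls : (Fin 4 → ℤ) → ℤ × (Fin 4 → ZMod 2520) := fun x => (quatNorm x, fun i => (x i : ZMod 2520))
  let T : Set (Fin 4 → ℤ) := {x | x ≠ 0 ∧ |quatNorm x| ≤ 8}
  have hfin : (cls '' T).Finite := by
    refine ((Set.finite_Icc (-8 : ℤ) 8).prod (Set.finite_univ (α := Fin 4 → ZMod 2520))).subset ?_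
    rintro _ ⟨x, ⟨-, hx⟩, rfl⟩
    exact ⟨abs_le.1 hx, Set.mem_univ _⟩
  obtain ⟨T', hT'T, hT'fin, hT'⟩ : ∃ T' ⊆ T, T'.Finite ∧ cls '' T' = cls '' T := by
    obtain ⟨T', h1, h2⟩ := Set.exists_subset_bijOn T cls
    exact ⟨T', h1, h2.finite_iff_finite.2 hfin, h2.image_eq⟩
  obtain ⟨C, hC⟩ := (hT'fin.image fun c => 3 * (‖quatFst c‖ + ‖quatSnd c‖)).bddAbove
  refine ⟨C, fun g => ?_⟩
  obtain ⟨x, hx0, hx1, hx2⟩ := exists_quat_bounded g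
  have hxT : cls x ∈ cls '' T' := by
    rw [hT']
    exact ⟨x, ⟨hx0, abs_quatNorm_le g x hx1 hx2⟩, rfl⟩
  obtain ⟨c, hcT', hcx⟩ := hxT
  obtain ⟨hc0, hc8⟩ := hT'T hcT'
  have hN : quatNorm c = quatNorm x := congrArg Prod.fst hcx
  have hcN : quatNorm c ≠ 0 := fun h => hc0 (quatNorm_eq_zero h)
  have hdvd : 3 * quatNorm c ∣ 2520 := by
    generalize quatNorm c = m at hc8 hcN
    obtain ⟨h1, h2⟩ := abs_le.1 hc8
    interval_cases m <;> first | exact absurd rfl hcN | decide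
  obtain ⟨γ, hγ, hγa, hγb⟩ := exists_mem_congruenceLattice hN.symm hcN fun i => by
    refine hdvd.trans ?_
    have h : ((c i : ℤ) : ZMod 2520) = (x i : ℤ) := congrFun (congrArg Prod.snd hcx) i
    exact_mod_cast (ZMod.intCast_eq_intCast_iff_dvd_sub _ _ 2520).1 h
  refine ⟨γ, hγ, le_trans ?_ (hC ⟨c, hcT', rfl⟩)⟩
  -- The first entry of m gγ = (gx) c̄.
  have e : (quatNorm c : ℂ) * a (g * γ) =
      (a g * quatFst x + b g * conj (quatSnd x)) * conj (quatFst c) -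
        (a g * quatSnd x + b g * conj (quatFst x)) * conj (quatSnd c) := by
    have hγb' := congrArg conj hγb
    simp only [map_mul, map_sub, map_intCast] at hγb'
    rw [a_mul]
    linear_combination a g * hγa + b g * hγb'
  have h1 : (1 : ℝ) ≤ ‖(quatNorm c : ℂ)‖ := by
    rw [Complex.norm_intCast]
    exact_mod_cast Int.one_le_abs hcN
  have key : ∀ y : ℂ, ‖y‖ ^ 2 ≤ 8 → ‖y‖ ≤ 3 := fun y hy => by nlinarith [norm_nonneg y]
  calc ‖a (g * γ)‖ ≤ ‖(quatNorm c : ℂ)‖ * ‖a (g * γ)‖ :=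
        le_mul_of_one_le_left (norm_nonneg _) h1
    _ = ‖(quatNorm c : ℂ) * a (g * γ)‖ := (norm_mul _ _).symm
    _ ≤ 3 * ‖quatFst c‖ + 3 * ‖quatSnd c‖ := by
      rw [e]
      refine (norm_sub_le _ _).trans ?_
      rw [norm_mul, norm_mul, Complex.norm_conj, Complex.norm_conj]
      gcongr
      · exact key _ hx1
      · exact key _ hx2
    _ = _ := by ring

end SU11

lemma isTorsionFreeUniformLattice_congruenceLattice :
    IsTorsionFreeUniformLattice SU11.congruenceLattice where
  discrete := SU11.congruenceLattice_discrete
  torsionFree := SU11.congruenceLattice_torsionFree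
  cocompact := by
    obtain ⟨C, hC⟩ := SU11.exists_norm_a_mul_le
    refine ⟨?_⟩
    convert (SU11.isCompact_norm_a_le C).image
      (QuotientGroup.continuous_mk (N := SU11.congruenceLattice))
    symm
    rw [Set.eq_univ_iff_forall]
    intro x
    obtain ⟨g, rfl⟩ := QuotientGroup.mk_surjective x
    obtain ⟨γ, hγ, hle⟩ := hC g
    exact ⟨g * γ, hle, QuotientGroup.mk_mul_of_mem g hγ⟩

/-! ## Quotients of manifolds by covering group actions -/

section QuotientManifold

variable {Γ X Y H : Type*} [Group Γ] [TopologicalSpace X] [TopologicalSpace Y]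
  [TopologicalSpace H] [MulAction Γ X] {p : X → Y}

lemma IsQuotientCoveringMap.exists_section (hp : IsQuotientCoveringMap p Γ) (y : Y) :
    ∃ (q : OpenPartialHomeomorph X Y) (x : X), ⇑q = p ∧ x ∈ q.source ∧ p x = y := by
  obtain ⟨x, rfl⟩ := hp.surjective y
  obtain ⟨q, hx, hq⟩ := hp.isCoveringMap.isLocalHomeomorph x
  exact ⟨q, x, hq.symm, hx, rfl⟩

lemma mem_source_symm_trans {q : OpenPartialHomeomorph X Y} (hq : ⇑q = p) {x : X} {y : Y}
    (hx : x ∈ q.source) (hy : p x = y) {e : OpenPartialHomeomorph X H} (he : x ∈ e.source) :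
    y ∈ (q.symm ≫ₕ e).source := by
  subst hy hq
  simp [hx, he]

variable (H) in
/-- The charts of a quotient of a manifold by a covering group action are the compositions of the
local sections of the quotient map with the charts of the manifold. -/
@[reducible]
def IsQuotientCoveringMap.chartedSpace [ChartedSpace H X] (hp : IsQuotientCoveringMap p Γ) :
    ChartedSpace H Y where
  atlas := {e | ∃ q : OpenPartialHomeomorph X Y, ⇑q = p ∧ ∃ e' ∈ atlas H X, e = q.symm ≫ₕ e'}
  chartAt y := (hp.exists_section y).choose.symm ≫ₕ
    chartAt H (hp.exists_section y).choose_spec.choose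
  mem_chart_source y :=
    have h := (hp.exists_section y).choose_spec.choose_spec
    mem_source_symm_trans h.1 h.2.1 h.2.2 (mem_chart_source H _)
  chart_mem_atlas y := ⟨_, (hp.exists_section y).choose_spec.choose_spec.1, _,
    chart_mem_atlas H _, rfl⟩

lemma IsQuotientCoveringMap.exists_chartAt_eq [ChartedSpace H X]
    (hp : IsQuotientCoveringMap p Γ) (y : Y) :
    ∃ (q : OpenPartialHomeomorph X Y) (x : X), ⇑q = p ∧ x ∈ q.source ∧ p x = y ∧
      (hp.chartedSpace H).chartAt y = q.symm ≫ₕ chartAt H x :=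
  ⟨_, _, (hp.exists_section y).choose_spec.choose_spec.1,
    (hp.exists_section y).choose_spec.choose_spec.2.1,
    (hp.exists_section y).choose_spec.choose_spec.2.2, rfl⟩

/-- The coordinate expression of the transformation `γ`. -/
def smulInCharts [ContinuousConstSMul Γ X] (γ : Γ) (e e' : OpenPartialHomeomorph X H) :
    OpenPartialHomeomorph H H :=
  e.symm ≫ₕ (Homeomorph.smul γ).toOpenPartialHomeomorph ≫ₕ e'

lemma smulInCharts_symm [ContinuousConstSMul Γ X] (γ : Γ) (e e' : OpenPartialHomeomorph X H) :
    (smulInCharts γ e e').symm = smulInCharts γ⁻¹ e' e := by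
  unfold smulInCharts
  rw [OpenPartialHomeomorph.trans_symm_eq_symm_trans_symm,
    OpenPartialHomeomorph.trans_symm_eq_symm_trans_symm, OpenPartialHomeomorph.trans_assoc,
    OpenPartialHomeomorph.symm_symm]
  congr 2
  ext <;> simp

lemma mem_smulInCharts_source [ContinuousConstSMul Γ X] {γ : Γ}
    {e e' : OpenPartialHomeomorph X H} {u : H} :
    u ∈ (smulInCharts γ e e').source ↔ u ∈ e.target ∧ γ • e.symm u ∈ e'.source := by
  simp [smulInCharts]

/-- Two local sections of the covering differ, near each point, by a single element of Γ. Membership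
in a groupoid is local, so the coordinate expressions of the elements of Γ suffice. -/
lemma IsQuotientCoveringMap.transition_mem [ContinuousConstSMul Γ X]
    (hp : IsQuotientCoveringMap p Γ)
    {G : StructureGroupoid H} [ClosedUnderRestriction G] {e e' : OpenPartialHomeomorph X H}
    (hG : ∀ γ : Γ, smulInCharts γ e e' ∈ G)
    {q q' : OpenPartialHomeomorph X Y} (hq : ⇑q = p) (hq' : ⇑q' = p) :
    (q.symm ≫ₕ e).symm ≫ₕ q'.symm ≫ₕ e' ∈ G := by
  apply G.locality
  intro u hu
  have hu' := hu
  simp only [OpenPartialHomeomorph.trans_symm_eq_symm_trans_symm, OpenPartialHomeomorph.symm_symm,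
    OpenPartialHomeomorph.trans_source, OpenPartialHomeomorph.symm_source, Set.mem_inter_iff,
    Set.mem_preimage, OpenPartialHomeomorph.coe_trans, Function.comp_apply] at hu'
  obtain ⟨⟨hu1, hu2⟩, hu3, hu4⟩ := hu'
  have hpp : p (q'.symm (q (e.symm u))) = p (e.symm u) := by
    rw [← hq', q'.right_inv hu3, hq, hq']
  obtain ⟨γ, hγ⟩ := hp.apply_eq_iff_mem_orbit.1 hpp
  simp only at hγ
  -- On this set, which contains the given point, `q'.symm ∘ q` is the transformation γ.
  have hW : IsOpen (q.source ∩ (fun x => γ • x) ⁻¹' q'.source) :=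
    q.open_source.inter (q'.open_source.preimage (continuous_const_smul γ))
  have hs := (smulInCharts γ e e').open_source.inter (e.symm.isOpen_inter_preimage hW)
  refine ⟨_, hs, ⟨?_, hu1, ?_⟩, ?_⟩
  · rw [mem_smulInCharts_source, hγ]
    exact ⟨hu1, hu4⟩
  · refine ⟨hu2, ?_⟩
    change γ • e.symm u ∈ q'.source
    rw [hγ]
    exact q'.map_target hu3
  · refine StructureGroupoid.restr_mem_of_eqOn (hG γ) hs ?_ fun v hv => hv.2.1
    rintro v ⟨hv, -, hv1, hv2⟩
    change γ • e.symm v ∈ q'.source at hv2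
    change e' (γ • e.symm v) = e' (q'.symm (q (e.symm v)))
    rw [hq, ← hp.map_smul γ, ← hq', q'.left_inv hv2]

lemma IsQuotientCoveringMap.hasGroupoid [ChartedSpace H X] [ContinuousConstSMul Γ X]
    (hp : IsQuotientCoveringMap p Γ)
    (G : StructureGroupoid H) [ClosedUnderRestriction G]
    (hG : ∀ γ : Γ, ∀ e ∈ atlas H X, ∀ e' ∈ atlas H X, smulInCharts γ e e' ∈ G) :
    @HasGroupoid H _ Y _ (hp.chartedSpace H) G := by
  let _ := hp.chartedSpace H
  refine ⟨?_⟩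
  rintro _ _ ⟨q, hq, e, he, rfl⟩ ⟨q', hq', e', he', rfl⟩
  exact hp.transition_mem (fun γ => hG γ e he e' he') hq hq'

/-- The chart at `p x` may come from another point x' of the orbit of x, so in charts p is a change
between two sheets rather than the identity. -/
lemma IsQuotientCoveringMap.liftProp [ChartedSpace H X] [ContinuousConstSMul Γ X]
    (hp : IsQuotientCoveringMap p Γ)
    (G : StructureGroupoid H) [ClosedUnderRestriction G]
    (hG : ∀ γ : Γ, ∀ e ∈ atlas H X, ∀ e' ∈ atlas H X, smulInCharts γ e e' ∈ G) :
    letI := hp.chartedSpace H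
    ChartedSpace.LiftProp G.IsLocalStructomorphWithinAt p := by
  let _ := hp.chartedSpace H
  rw [ChartedSpace.liftProp_iff]
  refine ⟨hp.continuous, fun x _ => ?_⟩
  obtain ⟨q, x', hq, hx', hxx', hch⟩ := hp.exists_chartAt_eq (H := H) (p x)
  obtain ⟨q₀, hx₀, hq₀⟩ := hp.isCoveringMap.isLocalHomeomorph x
  change chartAt H (p x) = _ at hch
  refine ⟨(q₀.symm ≫ₕ chartAt H x).symm ≫ₕ q.symm ≫ₕ chartAt H x',
    hp.transition_mem (fun γ => hG γ _ (chart_mem_atlas H x) _ (chart_mem_atlas H x')) hq₀.symm hq,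
    ?_, ?_⟩
  · rintro u -
    rw [hch, hq₀]
    rfl
  · have h1 : q.symm (p x) = x' := by rw [← hxx', ← hq, q.left_inv hx']
    have h2 : p x ∈ q.target := by
      rw [← hxx', ← hq]
      exact q.map_source hx'
    simp [hx₀, ← hq₀, h1, h2]

end QuotientManifold

section QuotientFunctions

variable {Γ X Y H : Type*} [Group Γ] [TopologicalSpace X] [TopologicalSpace Y]
  [TopologicalSpace H] [MulAction Γ X] [ChartedSpace H X] {p : X → Y}

/-- Every chart of the quotient is a chart upstairs after a lift. -/
lemma IsQuotientCoveringMap.exists_of_mem_atlas (hp : IsQuotientCoveringMap p Γ)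
    {e : OpenPartialHomeomorph Y H} (he : e ∈ (hp.chartedSpace H).atlas) :
    ∃ e' ∈ atlas H X, e.target ⊆ e'.target ∧ ∀ u, e.symm u = p (e'.symm u) := by
  obtain ⟨q, hq, e', he', rfl⟩ := he
  refine ⟨e', he', fun u hu => hu.1, fun u => ?_⟩
  rw [← hq]
  rfl

end QuotientFunctions

/-! ### Leaves of the quotient, by path lifting -/

section Leaves

variable {Γ T X M E : Type*} [Group Γ] [TopologicalSpace T] [TopologicalSpace X]
  [TopologicalSpace M] [NormedAddCommGroup E] [MulAction Γ T] [MulAction Γ X]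
  [ChartedSpace ℂ T] [ChartedSpace E X] {p : T × X → M}

/-- The chart at `p (δ t)` passes through a sheet around γ • δ t for some γ. There its transverse
coordinate is a chart of X applied to γ • (δ s).2, and both that chart and γ are injective. -/
lemma IsQuotientCoveringMap.eventually_plaque_iff (hp : IsQuotientCoveringMap p Γ)
    (δ : C(unitInterval, T × X)) (t : unitInterval) :
    letI := hp.chartedSpace (ModelProd ℂ E)
    (∀ᶠ s in 𝓝 t, (chartAt (ModelProd ℂ E) (p (δ t)) (p (δ s))).2 =
      (chartAt (ModelProd ℂ E) (p (δ t)) (p (δ t))).2) ↔ ∀ᶠ s in 𝓝 t, (δ s).2 = (δ t).2 := by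
  let _ := hp.chartedSpace (ModelProd ℂ E)
  have := hp.toContinuousConstSMul
  obtain ⟨q, x, hq, hx, hxx, hch⟩ := hp.exists_chartAt_eq (H := ModelProd ℂ E) (p (δ t))
  change chartAt (ModelProd ℂ E) (p (δ t)) = _ at hch
  obtain ⟨γ, hγ⟩ := hp.apply_eq_iff_mem_orbit.1 hxx
  change γ • δ t = x at hγ
  have hc : Continuous fun s => γ • δ s := δ.continuous.const_smul γ
  have hev1 : ∀ᶠ s in 𝓝 t, γ • δ s ∈ q.source :=
    hc.continuousAt.eventually_mem (q.open_source.mem_nhds (by rwa [hγ]))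
  have hev2 : ∀ᶠ s in 𝓝 t, (γ • δ s).2 ∈ (chartAt E x.2).source :=
    (continuous_snd.comp hc).continuousAt.eventually_mem
      ((chartAt E x.2).open_source.mem_nhds (by
        change (γ • δ t).2 ∈ _
        rw [hγ]
        exact mem_chart_source E x.2))
  have key : ∀ s, γ • δ s ∈ q.source → (chartAt (ModelProd ℂ E) (p (δ t)) (p (δ s))).2 =
      chartAt E x.2 (γ • δ s).2 := by
    intro s hs
    rw [hch]
    change (chartAt (ModelProd ℂ E) x (q.symm (p (δ s)))).2 = _
    rw [← hp.map_smul γ, ← hq, q.left_inv hs]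
    rfl
  have hkt := key t hev1.self_of_nhds
  have hst := hev2.self_of_nhds
  refine Filter.eventually_congr ?_
  filter_upwards [hev1, hev2] with s hs1 hs2
  rw [key s hs1, hkt, (chartAt E x.2).injOn.eq_iff hs2 hst, Prod.smul_snd, Prod.smul_snd,
    smul_left_cancel_iff]

/-- A path that stays locally in plaques lifts to T × X with locally constant second component,
which is constant as the interval is connected. Conversely, paths in T × {x} project to such paths.
-/
lemma IsQuotientCoveringMap.leaf_eq [NormedSpace ℝ E] [PathConnectedSpace T] (hp : IsQuotientCoveringMap p Γ)
    (z : T) (x : X) :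
    letI := hp.chartedSpace (ModelProd ℂ E)
    leaf E (p (z, x)) = Set.range fun w : T => p (w, x) := by
  let _ := hp.chartedSpace (ModelProd ℂ E)
  apply Set.Subset.antisymm
  · rintro y ⟨γ, hγ⟩
    obtain ⟨δ, hδ0, hδ⟩ : ∃ δ : C(unitInterval, T × X), δ 0 = (z, x) ∧ ∀ s, p (δ s) = γ s :=
      ⟨hp.isCoveringMap.liftPath γ (z, x) γ.source, hp.isCoveringMap.liftPath_zero _ _ _,
        congrFun (hp.isCoveringMap.liftPath_lifts _ _ _)⟩
    have hloc : IsLocallyConstant fun s => (δ s).2 := by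
      rw [IsLocallyConstant.iff_eventually_eq]
      intro t
      rw [← hp.eventually_plaque_iff (E := E)]
      simpa only [hδ] using hγ t
    have h01 : (δ 1).2 = x := by
      rw [hloc.apply_eq_of_preconnectedSpace 1 0, hδ0]
    refine ⟨(δ 1).1, ?_⟩
    change p ((δ 1).1, x) = y
    rw [← h01]
    change p (δ 1) = y
    rw [hδ, γ.target]
  · rintro _ ⟨w, rfl⟩
    let η : Path z w := PathConnectedSpace.somePath z w
    let δ : C(unitInterval, T × X) := ⟨fun s => (η s, x), by fun_prop⟩
    refine ⟨⟨⟨fun s => p (δ s), hp.continuous.comp δ.continuous⟩, by simp [δ], by simp [δ]⟩,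
      fun t => (hp.eventually_plaque_iff δ t).2 ?_⟩
    exact Filter.Eventually.of_forall fun s => rfl

end Leaves

/-! ### Local triviality over the base -/

section Bundle

variable {Γ T X M S : Type*} [Group Γ] [TopologicalSpace T] [TopologicalSpace X]
  [TopologicalSpace M] [TopologicalSpace S] [MulAction Γ T] [MulAction Γ X]
  {p : T × X → M} {π : T → S}

/-- Over the image of a sheet U of T → S, the map p is injective on U × X because Γ acts freely on
T, and each point above that image has a representative there. The inverse of p on U × X is the
trivialization. -/
lemma IsQuotientCoveringMap.exists_bundle [Nonempty X] (hp : IsQuotientCoveringMap p Γ)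
    (hπ : IsQuotientCoveringMap π Γ) :
    ∃ proj : M → S, (∀ (z : T) (x : X), proj (p (z, x)) = π z) ∧
      ∀ s : S, ∃ e : Bundle.Trivialization X proj, s ∈ e.baseSet := by
  have hfac : ∀ u v, p u = p v → π u.1 = π v.1 := by
    intro u v huv
    obtain ⟨γ, hγ⟩ := hp.apply_eq_iff_mem_orbit.1 huv
    rw [← hγ]
    exact hπ.map_smul γ
  obtain ⟨proj, hproj⟩ : ∃ proj : M → S, ∀ u, proj (p u) = π u.1 :=
    ⟨fun m => π (Function.surjInv hp.surjective m).1, fun u =>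
      hfac _ _ (Function.surjInv_eq hp.surjective _)⟩
  refine ⟨proj, fun z x => hproj (z, x), fun s => ?_⟩
  obtain ⟨q, z, hq, hz, rfl⟩ := hπ.exists_section s
  have hcancel := hπ.isCancelSMul
  have hinj : Set.InjOn p (q.source ×ˢ Set.univ) := by
    rintro u ⟨hu, -⟩ v ⟨hv, -⟩ huv
    have h1 : u.1 = v.1 := q.injOn hu hv (by rw [hq]; exact hfac u v huv)
    obtain ⟨γ, hγ⟩ := hp.apply_eq_iff_mem_orbit.1 huv
    change γ • v = u at hγ
    have h2 : γ • v.1 = v.1 := (congrArg Prod.fst hγ).trans h1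
    have h3 : γ = 1 := isCancelSMul_iff_eq_one_of_smul_eq.1 hcancel γ v.1 h2
    rw [← hγ, h3, one_smul]
  have : Nonempty T := ⟨z⟩
  let Q : OpenPartialHomeomorph (T × X) M := .ofContinuousOpen (hinj.toPartialEquiv)
    hp.continuous.continuousOn hp.isCoveringMap.isOpenMap (q.open_source.prod isOpen_univ)
  have hQt : Q.target = proj ⁻¹' q.target := by
    ext m
    constructor
    · rintro ⟨u, ⟨hu, -⟩, rfl⟩
      rw [Set.mem_preimage, hproj, ← hq]
      exact q.map_source hu
    · intro hm
      obtain ⟨u, rfl⟩ := hp.surjective m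
      rw [Set.mem_preimage, hproj] at hm
      have h1 : π (q.symm (π u.1)) = π u.1 :=
        (congrFun hq _).symm.trans (q.right_inv hm)
      obtain ⟨γ, hγ⟩ := hπ.apply_eq_iff_mem_orbit.1 h1
      change γ • u.1 = q.symm (π u.1) at hγ
      refine ⟨γ • u, ⟨?_, Set.mem_univ _⟩, hp.map_smul γ⟩
      rw [Prod.smul_fst, hγ]
      exact q.map_target hm
  refine ⟨
    { Q.symm ≫ₕ q.prod (.refl X) with
      baseSet := q.target
      open_baseSet := q.open_target
      source_eq := ?_
      target_eq := ?_
      proj_toFun := ?_ }, ?_⟩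
  · change Q.target ∩ Q.symm ⁻¹' (q.source ×ˢ Set.univ) = _
    rw [hQt.symm, Set.inter_eq_left]
    exact fun m hm => Q.map_target hm
  · change (q.target ×ˢ Set.univ) ∩ (q.prod (.refl X)).symm ⁻¹' (q.source ×ˢ Set.univ) = _
    rw [Set.inter_eq_left]
    exact fun m hm => ⟨q.map_target hm.1, Set.mem_univ _⟩
  · rintro m ⟨hm, -⟩
    change q (Q.symm m).1 = proj m
    conv_rhs => rw [← Q.right_inv hm]
    rw [hq]
    exact (hproj _).symm
  · change π z ∈ q.target
    rw [← hq]
    exact q.map_source hz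

end Bundle

/-! ## Changes of affine charts of projective spaces -/

lemma mem_contDiffGroupoid_self {𝕜 E : Type*} [NontriviallyNormedField 𝕜] [NormedAddCommGroup E]
    [NormedSpace 𝕜 E] {n : ℕ∞ω} {e : OpenPartialHomeomorph E E} :
    e ∈ contDiffGroupoid n 𝓘(𝕜, E) ↔
      ContDiffOn 𝕜 n e e.source ∧ ContDiffOn 𝕜 n e.symm e.target := by
  rw [contDiffGroupoid, mem_groupoid_of_pregroupoid]
  simp [contDiffPregroupoid]

section ProjectiveTransitions

variable {V : Type*} [NormedAddCommGroup V] [NormedSpace ℝ V] {n : ℕ}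

lemma contDiff_insertNth_one (i : Fin (n + 1)) :
    ContDiff ℝ ω fun y : EuclideanSpace ℝ (Fin n) =>
      (i.insertNth (1 : ℝ) (fun j => y j) : Fin (n + 1) → ℝ) := by
  rw [contDiff_pi]
  intro k
  refine Fin.succAboveCases i ?_ (fun j => ?_) k
  · simpa using contDiff_const
  · simp only [Fin.insertNth_apply_succAbove]
    fun_prop

/-- The affine coordinates of the image of a point under a linear map. -/
lemma contDiffOn_affineCoords (c c' : V ≃L[ℝ] (Fin (n + 1) → ℝ)) (i i' : Fin (n + 1))
    (A : V →L[ℝ] V) :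
    ContDiffOn ℝ ω (fun y : EuclideanSpace ℝ (Fin n) => WithLp.toLp 2 fun j =>
        c' (A (c.symm (i.insertNth (1 : ℝ) (fun j => y j)))) (i'.succAbove j) /
        c' (A (c.symm (i.insertNth (1 : ℝ) (fun j => y j)))) i')
      {y | c' (A (c.symm (i.insertNth (1 : ℝ) (fun j => y j)))) i' ≠ 0} := by
  have h : ContDiff ℝ ω fun y : EuclideanSpace ℝ (Fin n) =>
      c' (A (c.symm (i.insertNth (1 : ℝ) (fun j => y j)))) :=
    c'.contDiff.comp (A.contDiff.comp (c.symm.contDiff.comp (contDiff_insertNth_one i)))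
  rw [contDiff_pi] at h
  rw [contDiffOn_euclidean]
  intro j
  exact (h (i'.succAbove j)).contDiffOn.div (h i').contDiffOn fun y hy => hy

lemma projChart_trans_mem (c c' : V ≃L[ℝ] (Fin (n + 1) → ℝ)) (i i' : Fin (n + 1)) :
    (projChart c i).symm ≫ₕ projChart c' i' ∈
      contDiffGroupoid ω 𝓘(ℝ, EuclideanSpace ℝ (Fin n)) := by
  have key : ∀ (c c' : V ≃L[ℝ] (Fin (n + 1) → ℝ)) (i i' : Fin (n + 1)),
      ContDiffOn ℝ ω ((projChart c i).symm ≫ₕ projChart c' i')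
        ((projChart c i).symm ≫ₕ projChart c' i').source := fun c c' i i' =>
    (contDiffOn_affineCoords c c' i i' (.id ℝ V)).mono fun y hy => hy.2
  rw [mem_contDiffGroupoid_self]
  refine ⟨key c c' i i', ?_⟩
  have h := key c' c i' i
  rwa [← OpenPartialHomeomorph.symm_symm ((projChart c' i').symm ≫ₕ projChart c i),
    OpenPartialHomeomorph.trans_symm_eq_symm_trans_symm, OpenPartialHomeomorph.symm_symm] at h

end ProjectiveTransitions

/-! ## The charts of the quadric -/

/-- Light cone coordinates on `ℂ² × ℝ`. -/
def lightCoords (ζ : Circle) : HomCoords ≃L[ℝ] (Fin (4 + 1) → ℝ) :=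
  LinearEquiv.toContinuousLinearEquiv
    { toFun := fun v => ![(ζ * v.1).re + v.2.2, (ζ * v.1).im, v.2.1.re, v.2.1.im,
        (ζ * v.1).re - v.2.2]
      invFun := fun x => ((ζ⁻¹ : Circle) * (⟨(x 0 + x 4) / 2, x 1⟩ : ℂ), ⟨x 2, x 3⟩,
        (x 0 - x 4) / 2)
      map_add' := fun v w => by ext k; fin_cases k <;> simp [mul_add] <;> ring
      map_smul' := fun r v => by ext k; fin_cases k <;> simp <;> ring
      left_inv := fun v => by
        obtain ⟨z, w, t⟩ := v
        have h : (⟨((ζ * z).re + t + ((ζ * z).re - t)) / 2, (ζ * z).im⟩ : ℂ) = ζ * z := by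
          apply Complex.ext
          · change ((ζ * z).re + t + ((ζ * z).re - t)) / 2 = _
            ring
          · rfl
        have h2 : ((ζ * z).re + t - ((ζ * z).re - t)) / 2 = t := by ring
        change (((ζ⁻¹ : Circle) : ℂ) * ⟨((ζ * z).re + t + ((ζ * z).re - t)) / 2, (ζ * z).im⟩, w,
          ((ζ * z).re + t - ((ζ * z).re - t)) / 2) = _
        rw [h, h2, ← mul_assoc, ← Circle.coe_mul, inv_mul_cancel, Circle.coe_one, one_mul]
      right_inv := fun x => by
        have h : (ζ : ℂ) * (((ζ⁻¹ : Circle) : ℂ) * (⟨(x 0 + x 4) / 2, x 1⟩ : ℂ)) =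
            ⟨(x 0 + x 4) / 2, x 1⟩ := by
          rw [← mul_assoc, ← Circle.coe_mul, mul_inv_cancel, Circle.coe_one, one_mul]
        ext k
        simp only [h]
        fin_cases k <;> simp <;> ring }

lemma lightCoords_apply (ζ : Circle) (v : HomCoords) : lightCoords ζ v =
    ![(ζ * v.1).re + v.2.2, (ζ * v.1).im, v.2.1.re, v.2.1.im, (ζ * v.1).re - v.2.2] := rfl

/-- |z₁|² - t² factors as (Re ζz₁ + t)(Re ζz₁ - t) plus (Im ζz₁)². In the affine chart x₀ = 1 the
equation is linear in x₄, so the quadric is a graph over all of ℝ³. -/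
lemma onQuadric_iff_lightCoords (ζ : Circle) (v : HomCoords) : OnQuadric v ↔
    lightCoords ζ v 0 * lightCoords ζ v 4 =
      lightCoords ζ v 2 ^ 2 + lightCoords ζ v 3 ^ 2 - lightCoords ζ v 1 ^ 2 := by
  have h : ‖v.1‖ ^ 2 = (ζ * v.1).re ^ 2 + (ζ * v.1).im ^ 2 := by
    have h1 : ‖v.1‖ = ‖(ζ : ℂ) * v.1‖ := by rw [norm_mul, Circle.norm_coe, one_mul]
    rw [h1, ← Complex.normSq_eq_norm_sq, Complex.normSq_apply]
    ring
  have h2 : ‖v.2.1‖ ^ 2 = v.2.1.re ^ 2 + v.2.1.im ^ 2 := by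
    rw [← Complex.normSq_eq_norm_sq, Complex.normSq_apply]
    ring
  rw [OnQuadric, h, h2]
  simp only [lightCoords_apply, Matrix.cons_val]
  constructor <;> intro h <;> linarith

/-- The isomorphism of `ℝ³ × ℝ` with `ℝ⁴`. -/
def euclideanSnoc :
    (EuclideanSpace ℝ (Fin 3) × ℝ) ≃L[ℝ] EuclideanSpace ℝ (Fin 4) :=
  LinearEquiv.toContinuousLinearEquiv
    { toFun := fun p => !₂[p.1 0, p.1 1, p.1 2, p.2]
      invFun := fun x => (!₂[x 0, x 1, x 2], x 3)
      map_add' := fun p q => by ext k; fin_cases k <;> simp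
      map_smul' := fun r p => by ext k; fin_cases k <;> simp
      left_inv := fun p => by
        refine Prod.ext ?_ rfl
        ext k
        fin_cases k <;> rfl
      right_inv := fun x => by ext k; fin_cases k <;> rfl }

/-- In an affine light cone chart the quadric is the graph of this quadratic form. -/
def lightForm (y : EuclideanSpace ℝ (Fin 3)) : ℝ := y 1 ^ 2 + y 2 ^ 2 - y 0 ^ 2

lemma contDiff_lightForm : ContDiff ℝ ω lightForm := by
  unfold lightForm
  fun_prop

/-- The affine chart of `ℝP⁴` given by light cone coordinates. -/
def lightChart (ζ : Circle) : OpenPartialHomeomorph RP4 (EuclideanSpace ℝ (Fin 4)) :=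
  projChart (lightCoords ζ) 0

lemma mem_quadric_iff_lightChart (ζ : Circle) {p : RP4} (hp : p ∈ (lightChart ζ).source) :
    p ∈ quadric ↔ (euclideanSnoc.symm (lightChart ζ p)).2 =
      lightForm (euclideanSnoc.symm (lightChart ζ p)).1 := by
  revert hp
  refine Projectivization.ind (fun v hv => ?_) p
  intro hp
  have h0 : lightCoords ζ v 0 ≠ 0 := hp
  change OnQuadric v ↔ lightCoords ζ v 4 / lightCoords ζ v 0 =
    (lightCoords ζ v 2 / lightCoords ζ v 0) ^ 2 + (lightCoords ζ v 3 / lightCoords ζ v 0) ^ 2 -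
      (lightCoords ζ v 1 / lightCoords ζ v 0) ^ 2
  rw [onQuadric_iff_lightCoords ζ v]
  generalize lightCoords ζ v = x at h0
  field_simp

lemma lightChart_symm_mem_source (ζ : Circle) (y : EuclideanSpace ℝ (Fin 4)) :
    (lightChart ζ).symm y ∈ (lightChart ζ).source := (lightChart ζ).map_target (Set.mem_univ _)

lemma lightChart_right_inv (ζ : Circle) (y : EuclideanSpace ℝ (Fin 4)) :
    lightChart ζ ((lightChart ζ).symm y) = y := (lightChart ζ).right_inv (Set.mem_univ _)

/-- The points of an affine light cone chart of the quadric. -/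
def quadricPoint (ζ : Circle) (y : EuclideanSpace ℝ (Fin 3)) : Quadric :=
  ⟨(lightChart ζ).symm (euclideanSnoc (y, lightForm y)), by
    rw [mem_quadric_iff_lightChart ζ (lightChart_symm_mem_source ζ _), lightChart_right_inv,
      ContinuousLinearEquiv.symm_apply_apply]⟩

/-- The charts of the quadric. -/
def quadricChart (ζ : Circle) : OpenPartialHomeomorph Quadric (EuclideanSpace ℝ (Fin 3)) where
  toFun p := (euclideanSnoc.symm (lightChart ζ p.1)).1
  invFun := quadricPoint ζ
  source := Subtype.val ⁻¹' (lightChart ζ).source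
  target := Set.univ
  map_source' _ _ := Set.mem_univ _
  map_target' y _ := lightChart_symm_mem_source ζ _
  left_inv' p hp := by
    apply Subtype.ext
    change (lightChart ζ).symm _ = _
    rw [← (mem_quadric_iff_lightChart ζ hp).1 p.2, Prod.mk.eta,
      ContinuousLinearEquiv.apply_symm_apply]
    exact (lightChart ζ).left_inv hp
  right_inv' y _ := by
    change (euclideanSnoc.symm (lightChart ζ ((lightChart ζ).symm _))).1 = y
    rw [lightChart_right_inv, ContinuousLinearEquiv.symm_apply_apply]
  open_source := (lightChart ζ).open_source.preimage continuous_subtype_val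
  open_target := isOpen_univ
  continuousOn_toFun := by
    refine continuous_fst.comp_continuousOn (euclideanSnoc.symm.continuous.comp_continuousOn ?_)
    exact (lightChart ζ).continuousOn.comp continuous_subtype_val.continuousOn fun p hp => hp
  continuousOn_invFun := by
    rw [continuousOn_univ]
    refine Continuous.subtype_mk ?_ _
    refine (continuousOn_univ.1 (lightChart ζ).continuousOn_symm).comp
      (euclideanSnoc.continuous.comp ?_)
    exact continuous_id.prodMk contDiff_lightForm.continuous

lemma fst_ne_zero_of_onQuadric {v : HomCoords} (hv : v ≠ 0) (h : OnQuadric v) : v.1 ≠ 0 := by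
  intro h0
  rw [OnQuadric, h0, norm_zero] at h
  have h1 : ‖v.2.1‖ = 0 := by nlinarith [sq_nonneg ‖v.2.1‖, sq_nonneg v.2.2]
  have h2 : v.2.2 = 0 := by nlinarith [sq_nonneg ‖v.2.1‖, sq_nonneg v.2.2]
  exact hv (Prod.ext h0 (Prod.ext (norm_eq_zero.1 h1) h2))

lemma exists_mem_quadricChart_source (p : Quadric) : ∃ ζ, p ∈ (quadricChart ζ).source := by
  obtain ⟨p, hp⟩ := p
  revert hp
  refine Projectivization.ind (fun v hv => ?_) p
  intro hp
  have hQ : OnQuadric v := hp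
  have h0 := fst_ne_zero_of_onQuadric hv hQ
  have hn : 0 < ‖v.1‖ := norm_pos_iff.2 h0
  have hunit : ∀ r : ℝ, |r| = ‖v.1‖ → ∃ ζ : Circle, (ζ : ℂ) * v.1 = r := by
    intro r hr
    have hmem : (r : ℂ) / v.1 ∈ Submonoid.unitSphere ℂ := by
      rw [← SetLike.mem_coe, Submonoid.coe_unitSphere, mem_sphere_zero_iff_norm, norm_div,
        Complex.norm_real, Real.norm_eq_abs, hr, div_self hn.ne']
    exact ⟨⟨_, hmem⟩, div_mul_cancel₀ _ h0⟩
  -- Rotate z₁ to ±|z₁| with the sign of t, so that the two terms of x₀ do not cancel.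
  rcases le_or_gt 0 v.2.2 with ht | ht
  · obtain ⟨ζ, hζ⟩ := hunit ‖v.1‖ (abs_norm _)
    refine ⟨ζ, ?_⟩
    change (ζ * v.1).re + v.2.2 ≠ 0
    rw [hζ, Complex.ofReal_re]
    positivity
  · obtain ⟨ζ, hζ⟩ := hunit (-‖v.1‖) (by rw [abs_neg, abs_norm])
    refine ⟨ζ, ?_⟩
    change (ζ * v.1).re + v.2.2 ≠ 0
    rw [hζ, Complex.ofReal_re]
    linarith

instance : ChartedSpace (EuclideanSpace ℝ (Fin 3)) Quadric where
  atlas := Set.range quadricChart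
  chartAt p := quadricChart (exists_mem_quadricChart_source p).choose
  mem_chart_source p := (exists_mem_quadricChart_source p).choose_spec
  chart_mem_atlas _ := ⟨_, rfl⟩

/-- The linear map `v ↦ g • v`. -/
def SU11.toLinear (g : SU11) : HomCoords →L[ℝ] HomCoords :=
  LinearMap.toContinuousLinearMap
    { toFun := fun v => g • v
      map_add' := smul_add g
      map_smul' := fun r v => smul_comm g r v }

/-- The map is rational, being linear in homogeneous coordinates. For g = 1 it is the change of
charts of the quadric. -/
lemma contDiffOn_quadricChart_smul (g : SU11) (ζ ζ' : Circle) :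
    ContDiffOn ℝ ω (fun y => quadricChart ζ' (g • (quadricChart ζ).symm y))
      {y | g • (quadricChart ζ).symm y ∈ (quadricChart ζ').source} := by
  have h1 : ContDiff ℝ ω fun y : EuclideanSpace ℝ (Fin 3) => euclideanSnoc (y, lightForm y) :=
    euclideanSnoc.contDiff.comp (contDiff_id.prodMk contDiff_lightForm)
  have h2 := (contDiffOn_affineCoords (lightCoords ζ) (lightCoords ζ') 0 0 (SU11.toLinear g)).comp
    (f := fun y => euclideanSnoc (y, lightForm y)) (s := {y | g • (quadricChart ζ).symm y ∈ (quadricChart ζ').source})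
    h1.contDiffOn fun y hy => hy
  exact contDiff_fst.comp_contDiffOn (euclideanSnoc.symm.contDiff.comp_contDiffOn h2)

instance : IsManifold 𝓘(ℝ, EuclideanSpace ℝ (Fin 3)) ω Quadric := by
  apply isManifold_of_contDiffOn
  rintro _ _ ⟨ζ, rfl⟩ ⟨ζ', rfl⟩
  refine (contDiffOn_quadricChart_smul 1 ζ ζ').congr_mono ?_ ?_
  · intro y _
    rw [one_smul]
    rfl
  · intro y hy
    change (1 : SU11) • (quadricChart ζ).symm y ∈ (quadricChart ζ').source
    rw [one_smul]
    exact hy.1.2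

/-- The chart of `ℝP⁴` in which the quadric is a hyperplane. -/
def shear : EuclideanSpace ℝ (Fin 4) ≃ₜ EuclideanSpace ℝ (Fin 4) where
  toFun x := euclideanSnoc ((euclideanSnoc.symm x).1,
    (euclideanSnoc.symm x).2 - lightForm (euclideanSnoc.symm x).1)
  invFun x := euclideanSnoc ((euclideanSnoc.symm x).1,
    (euclideanSnoc.symm x).2 + lightForm (euclideanSnoc.symm x).1)
  left_inv x := by simp
  right_inv x := by simp
  continuous_toFun := by
    have := contDiff_lightForm.continuous
    fun_prop
  continuous_invFun := by
    have := contDiff_lightForm.continuous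
    fun_prop

lemma shear_mem_contDiffGroupoid : shear.toOpenPartialHomeomorph ∈
    contDiffGroupoid ω 𝓘(ℝ, EuclideanSpace ℝ (Fin 4)) := by
  rw [mem_contDiffGroupoid_self]
  have h := contDiff_lightForm.comp (contDiff_fst.comp euclideanSnoc.symm.contDiff)
  have h1 := contDiff_fst.comp euclideanSnoc.symm.contDiff (n := ω)
  have h2 := contDiff_snd.comp euclideanSnoc.symm.contDiff (n := ω)
  exact ⟨(euclideanSnoc.contDiff.comp (h1.prodMk (h2.sub h))).contDiffOn,
    (euclideanSnoc.contDiff.comp (h1.prodMk (h2.add h))).contDiffOn⟩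

lemma lightChart_shear_mem_maximalAtlas (ζ : Circle) :
    lightChart ζ ≫ₕ shear.toOpenPartialHomeomorph ∈
      IsManifold.maximalAtlas 𝓘(ℝ, EuclideanSpace ℝ (Fin 4)) ω RP4 := by
  rw [IsManifold.maximalAtlas, mem_maximalAtlas_iff]
  rintro _ ⟨j, rfl⟩
  have hs := shear_mem_contDiffGroupoid
  constructor
  · rw [OpenPartialHomeomorph.trans_symm_eq_symm_trans_symm, OpenPartialHomeomorph.trans_assoc]
    exact StructureGroupoid.trans _ (StructureGroupoid.symm _ hs) (projChart_trans_mem _ _ _ _)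
  · rw [← OpenPartialHomeomorph.trans_assoc]
    exact StructureGroupoid.trans _ (projChart_trans_mem _ _ _ _) hs

/-- After subtracting the quadratic form from the last coordinate, the inclusion reads y ↦ (y, 0) in
charts. -/
lemma isSmoothEmbedding_quadric_val :
    Manifold.IsSmoothEmbedding 𝓘(ℝ, EuclideanSpace ℝ (Fin 3)) 𝓘(ℝ, EuclideanSpace ℝ (Fin 4)) ω
      (Subtype.val : Quadric → RP4) := by
  refine ⟨⟨ℝ, inferInstance, inferInstance, fun p => ?_⟩, Topology.IsEmbedding.subtypeVal⟩
  obtain ⟨ζ, hζ⟩ := exists_mem_quadricChart_source p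
  refine Manifold.IsImmersionAtOfComplement.mk_of_charts euclideanSnoc (quadricChart ζ)
    (lightChart ζ ≫ₕ shear.toOpenPartialHomeomorph) hζ ⟨hζ, Set.mem_univ _⟩
    (IsManifold.subset_maximalAtlas ⟨ζ, rfl⟩) (lightChart_shear_mem_maximalAtlas ζ)
    (fun x hx => ⟨hx, Set.mem_univ _⟩) ?_
  intro y _
  change shear (lightChart ζ ((lightChart ζ).symm (euclideanSnoc (y, lightForm y)))) =
    euclideanSnoc (y, 0)
  rw [lightChart_right_inv]
  simp [shear]

instance : ContinuousConstSMul SU11 Quadric where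
  continuous_const_smul g := by
    have h : Continuous fun p : RP4 => g • p := by
      rw [isQuotientMap_projMk.continuous_iff]
      have h1 : Continuous fun v : {v : HomCoords // v ≠ 0} => g • v.1 :=
        (SU11.toLinear g).continuous.comp continuous_subtype_val
      exact isQuotientMap_projMk.continuous.comp
        (h1.subtype_mk fun v => (smul_ne_zero_iff_ne g).2 v.2)
    exact (h.comp continuous_subtype_val).subtype_mk _

lemma contMDiff_quadric_smul (g : SU11) : ContMDiff 𝓘(ℝ, EuclideanSpace ℝ (Fin 3))
    𝓘(ℝ, EuclideanSpace ℝ (Fin 3)) ω fun p : Quadric => g • p := by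
  intro p
  rw [contMDiffAt_iff]
  refine ⟨(continuous_const_smul g).continuousAt, ?_⟩
  set ζ := (exists_mem_quadricChart_source p).choose with hζ
  set ζ' := (exists_mem_quadricChart_source (g • p)).choose with hζ'
  have ho : IsOpen {y | g • (quadricChart ζ).symm y ∈ (quadricChart ζ').source} :=
    (quadricChart ζ').open_source.preimage ((continuous_const_smul g).comp
      (continuousOn_univ.1 (quadricChart ζ).continuousOn_symm))
  refine ContDiffAt.contDiffWithinAt
    ((contDiffOn_quadricChart_smul g ζ ζ').contDiffAt (ho.mem_nhds ?_))
  change g • (quadricChart ζ).symm (quadricChart ζ p) ∈ (quadricChart ζ').source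
  rw [(quadricChart ζ).left_inv (exists_mem_quadricChart_source p).choose_spec]
  exact (exists_mem_quadricChart_source (g • p)).choose_spec

/-! ## The topology of the quadric -/

lemma real_smul_mk (r : ℝ) (hr : r ≠ 0) (v : HomCoords) (hv : v ≠ 0) :
    Projectivization.mk ℝ (r • v) (smul_ne_zero hr hv) = Projectivization.mk ℝ v hv :=
  (Projectivization.mk_eq_mk_iff' ℝ _ _ _ _).2 ⟨r, rfl⟩

lemma mk_mem_quadric {v : HomCoords} (hv : v ≠ 0) :
    Projectivization.mk ℝ v hv ∈ quadric ↔ OnQuadric v := Iff.rfl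

/-- Every point of the quadric has homogeneous coordinates with `‖z₁‖ = 1`. -/
lemma Quadric.exists_rep (p : Quadric) : ∃ (v : HomCoords) (hv : v ≠ 0), OnQuadric v ∧
    ‖v.1‖ = 1 ∧ Projectivization.mk ℝ v hv = p.1 := by
  obtain ⟨p, hp⟩ := p
  revert hp
  refine Projectivization.ind (fun v hv => ?_) p
  intro hp
  have hQ : OnQuadric v := hp
  have hn : ‖v.1‖ ≠ 0 := norm_ne_zero_iff.2 (fst_ne_zero_of_onQuadric hv hQ)
  refine ⟨‖v.1‖⁻¹ • v, smul_ne_zero (inv_ne_zero hn) hv,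
    (onQuadric_smul_real _ (inv_ne_zero hn) v).2 hQ, ?_, real_smul_mk _ (inv_ne_zero hn) v hv⟩
  rw [Prod.smul_fst, norm_smul, norm_inv, norm_norm, inv_mul_cancel₀ hn]

/-- The parametrization of the quadric by the product of a circle and a two-dimensional sphere. -/
def quadricParam (x : Metric.sphere (0 : ℂ) 1 × Metric.sphere (0 : EuclideanSpace ℝ (Fin 3)) 1) :
    Quadric :=
  ⟨Projectivization.mk ℝ ((x.1 : ℂ), (⟨x.2.1 0, x.2.1 1⟩ : ℂ), x.2.1 2) (by
    intro h
    have h1 : (x.1 : ℂ) = 0 := congrArg Prod.fst h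
    have h2 := mem_sphere_zero_iff_norm.1 x.1.2
    rw [h1, norm_zero] at h2
    exact zero_ne_one h2), by
    rw [mk_mem_quadric, OnQuadric]
    have h1 := mem_sphere_zero_iff_norm.1 x.1.2
    have h2 : ‖x.2.1‖ ^ 2 = 1 := by rw [mem_sphere_zero_iff_norm.1 x.2.2, one_pow]
    rw [EuclideanSpace.real_norm_sq_eq, Fin.sum_univ_three] at h2
    rw [h1, ← Complex.normSq_eq_norm_sq, Complex.normSq_mk]
    linarith⟩

lemma continuous_quadricParam : Continuous quadricParam := by
  refine Continuous.subtype_mk (isQuotientMap_projMk.continuous.comp (Continuous.subtype_mk ?_ _)) _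
  have h : Continuous fun y : EuclideanSpace ℝ (Fin 3) => (⟨y 0, y 1⟩ : ℂ) := by
    have : (fun y : EuclideanSpace ℝ (Fin 3) => (⟨y 0, y 1⟩ : ℂ)) =
        fun y => (y 0 : ℂ) + (y 1 : ℂ) * Complex.I := funext fun y => Complex.mk_eq_add_mul_I _ _
    rw [this]
    fun_prop
  refine (continuous_subtype_val.comp continuous_fst).prodMk
    ((h.comp (continuous_subtype_val.comp continuous_snd)).prodMk ?_)
  fun_prop

/-- Scaling to |z₁| = 1 turns the equation into |z₂|² + t² = 1. Compactness and connectedness of the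
quadric follow from those of S¹ × S². -/
lemma quadricParam_surjective : Function.Surjective quadricParam := by
  intro p
  obtain ⟨v, hv, hQ, h1, hp⟩ := p.exists_rep
  refine ⟨⟨⟨v.1, mem_sphere_zero_iff_norm.2 h1⟩, ⟨!₂[v.2.1.re, v.2.1.im, v.2.2], ?_⟩⟩, ?_⟩
  · rw [mem_sphere_zero_iff_norm, ← sq_eq_sq₀ (norm_nonneg _) zero_le_one,
      EuclideanSpace.real_norm_sq_eq, Fin.sum_univ_three]
    rw [OnQuadric, h1, ← Complex.normSq_eq_norm_sq, Complex.normSq_apply] at hQ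
    simp only [Matrix.cons_val]
    linarith
  · exact Subtype.ext hp

instance : CompactSpace Quadric :=
  ⟨quadricParam_surjective.range_eq ▸ isCompact_range continuous_quadricParam⟩

instance : ConnectedSpace Quadric := by
  have h1 : ConnectedSpace (Metric.sphere (0 : ℂ) 1) :=
    Subtype.connectedSpace (isConnected_sphere (by simp) _ zero_le_one)
  have h2 : ConnectedSpace (Metric.sphere (0 : EuclideanSpace ℝ (Fin 3)) 1) :=
    Subtype.connectedSpace (isConnected_sphere (by
      rw [← Module.finrank_eq_rank, finrank_euclideanSpace_fin]
      norm_num) _ zero_le_one)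
  exact quadricParam_surjective.connectedSpace continuous_quadricParam

/-- The functions `z₁²`, `z₁ z₂` and `t z₁`, normalized by `‖z₁‖²`; they separate the points of
the quadric. -/
def quadricInvariants : RP4 → ℂ × ℂ × ℂ :=
  Projectivization.lift (fun v => ((v.1.1 * v.1.1) / (‖v.1.1‖ ^ 2 : ℝ),
    (v.1.1 * v.1.2.1) / (‖v.1.1‖ ^ 2 : ℝ), (v.1.2.2 * v.1.1) / (‖v.1.1‖ ^ 2 : ℝ))) (by
    rintro ⟨v, hv⟩ ⟨w, hw⟩ t (rfl : v = t • w)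
    have ht : t ≠ 0 := fun h => hv (by simp [h])
    have ht2 : ((t ^ 2 : ℝ) : ℂ) ≠ 0 := by exact_mod_cast pow_ne_zero 2 ht
    have key : ∀ x : ℂ, (((t ^ 2 : ℝ) : ℂ) * x) / (‖(t • w).1‖ ^ 2 : ℝ) = x / (‖w.1‖ ^ 2 : ℝ) := by
      intro x
      rw [Prod.smul_fst, norm_smul, mul_pow, Real.norm_eq_abs, sq_abs, Complex.ofReal_mul,
        mul_div_mul_left _ _ ht2]
    simp only [← key]
    simp only [Prod.smul_fst, Prod.smul_snd, Complex.real_smul, smul_eq_mul]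
    push_cast
    refine Prod.ext ?_ (Prod.ext ?_ ?_) <;> simp only <;> congr 1 <;> ring)

lemma quadricInvariants_mk {v : HomCoords} (hv : v ≠ 0) (h1 : ‖v.1‖ = 1) :
    quadricInvariants (Projectivization.mk ℝ v hv) = (v.1 * v.1, v.1 * v.2.1, v.2.2 * v.1) := by
  change (_ / ((‖v.1‖ ^ 2 : ℝ) : ℂ), _ / ((‖v.1‖ ^ 2 : ℝ) : ℂ), _ / ((‖v.1‖ ^ 2 : ℝ) : ℂ)) = _
  simp [h1]

/-- The quadric lies in the open set z₁ ≠ 0, where the formulas do not divide by zero. -/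
lemma continuous_quadricInvariants : Continuous fun p : Quadric => quadricInvariants p.1 := by
  have hU : IsOpen {v : {v : HomCoords // v ≠ 0} | v.1.1 ≠ 0} :=
    isOpen_ne.preimage (continuous_fst.comp continuous_subtype_val)
  let U : Set RP4 := {p | (quadricInvariants p).1 ≠ 0}
  have hUU : Projectivization.mk' ℝ ⁻¹' U = {v : {v : HomCoords // v ≠ 0} | v.1.1 ≠ 0} := by
    ext v
    change (v.1.1 * v.1.1) / ((‖v.1.1‖ ^ 2 : ℝ) : ℂ) ≠ 0 ↔ v.1.1 ≠ 0
    simp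
  have hUo : IsOpen U := by
    rw [← isQuotientMap_projMk.isOpen_preimage, hUU]
    exact hU
  have hc : ContinuousOn quadricInvariants U := by
    rw [isQuotientMap_projMk.continuousOn_isOpen_iff hUo, hUU]
    have hz : Continuous fun v : {v : HomCoords // v ≠ 0} => v.1.1 := by fun_prop
    have hw : Continuous fun v : {v : HomCoords // v ≠ 0} => v.1.2.1 := by fun_prop
    have ht : Continuous fun v : {v : HomCoords // v ≠ 0} => (v.1.2.2 : ℂ) := by fun_prop
    have hn : Continuous fun v : {v : HomCoords // v ≠ 0} => ((‖v.1.1‖ ^ 2 : ℝ) : ℂ) := by fun_prop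
    have hn0 : ∀ v ∈ {v : {v : HomCoords // v ≠ 0} | v.1.1 ≠ 0}, ((‖v.1.1‖ ^ 2 : ℝ) : ℂ) ≠ 0 := by
      intro v hv
      have : ‖v.1.1‖ ≠ 0 := norm_ne_zero_iff.2 hv
      exact_mod_cast pow_ne_zero 2 this
    exact ((hz.mul hz).continuousOn.div hn.continuousOn hn0).prodMk
      (((hz.mul hw).continuousOn.div hn.continuousOn hn0).prodMk
        ((ht.mul hz).continuousOn.div hn.continuousOn hn0))
  refine hc.comp_continuous continuous_subtype_val fun p => ?_
  obtain ⟨v, hv, -, h1, hp⟩ := p.exists_rep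
  rw [← hp]
  change (quadricInvariants (Projectivization.mk ℝ v hv)).1 ≠ 0
  rw [quadricInvariants_mk hv h1]
  have : v.1 ≠ 0 := fun h => by simp [h] at h1
  simpa using this

/-- z₁² determines z₁ up to sign, and z₁z₂ and tz₁ then determine z₂ and t up to the same sign,
which is irrelevant projectively. This gives the Hausdorff property of the quadric. -/
lemma injective_quadricInvariants :
    Function.Injective fun p : Quadric => quadricInvariants p.1 := by
  intro p q hpq
  obtain ⟨v, hv, -, h1, hp⟩ := p.exists_rep
  obtain ⟨w, hw, -, h2, hq⟩ := q.exists_rep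
  simp only [← hp, ← hq, quadricInvariants_mk hv h1, quadricInvariants_mk hw h2,
    Prod.mk.injEq] at hpq
  obtain ⟨e1, e2, e3⟩ := hpq
  apply Subtype.ext
  rw [← hp, ← hq, Projectivization.mk_eq_mk_iff']
  have hw0 : w.1 ≠ 0 := fun h => by simp [h] at h2
  rcases mul_self_eq_mul_self_iff.1 e1 with h | h
  · rw [h] at e2 e3
    refine ⟨1, ?_⟩
    rw [one_smul]
    refine Prod.ext h.symm (Prod.ext (mul_left_cancel₀ hw0 e2).symm ?_)
    exact_mod_cast (mul_right_cancel₀ hw0 e3).symm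
  · rw [h] at e2 e3
    refine ⟨-1, ?_⟩
    rw [neg_one_smul]
    refine Prod.ext h.symm (Prod.ext (mul_left_cancel₀ hw0 ?_) ?_)
    · change w.1 * -w.2.1 = w.1 * v.2.1
      linear_combination e2
    · change -w.2.2 = v.2.2
      have h3 : (-w.2.2 : ℂ) = v.2.2 := mul_right_cancel₀ hw0 (by linear_combination e3)
      exact_mod_cast h3

instance : T2Space Quadric :=
  T2Space.of_injective_continuous injective_quadricInvariants continuous_quadricInvariants

/-! ## The quotients by a torsion-free uniform lattice -/

namespace Disc

instance : LocallyCompactSpace Disc := Disc.2.locallyCompactSpace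

instance : ContractibleSpace Disc :=
  (convex_ball (0 : ℂ) 1).contractibleSpace ⟨0, Metric.mem_ball_self one_pos⟩

/-- The centre of the disc. -/
def center : Disc := ⟨0, Metric.mem_ball_self one_pos⟩

/-- Transitivity, in the form that fits the map gΓ ↦ Γg⁻¹·0 from left cosets to orbits. The matrix
with α = (1 - |z|²)^(-1/2) and β = zα sends 0 to z. -/
lemma exists_smul_center (z : Disc) : ∃ g : SU11, g⁻¹ • center = z := by
  have hz := normSq_lt z
  have hpos : 0 < 1 - Complex.normSq (z : ℂ) := by linarith
  set α : ℝ := (√(1 - Complex.normSq (z : ℂ)))⁻¹ with hα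
  have hα0 : α ≠ 0 := inv_ne_zero (Real.sqrt_pos.2 hpos).ne'
  have h : Complex.normSq (α : ℂ) - Complex.normSq (z * α : ℂ) = 1 := by
    have h2 : α * α * (1 - Complex.normSq (z : ℂ)) = 1 := by
      rw [hα, ← mul_inv, Real.mul_self_sqrt hpos.le, inv_mul_cancel₀ hpos.ne']
    rw [Complex.normSq_mul, Complex.normSq_ofReal]
    linarith
  refine ⟨(SU11.ofEntries α (z * α) h)⁻¹, ?_⟩
  rw [inv_inv]
  apply Subtype.ext
  rw [coe_smul, SU11.a_ofEntries, SU11.b_ofEntries]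
  have hαC : (α : ℂ) ≠ 0 := by exact_mod_cast hα0
  simp [center, hαC]

end Disc

lemma IsOpenQuotientMap.exists_isCompact_image_eq_univ {X Y : Type*} [TopologicalSpace X]
    [TopologicalSpace Y] [LocallyCompactSpace X] [CompactSpace Y] {f : X → Y}
    (hf : IsOpenQuotientMap f) : ∃ K, IsCompact K ∧ f '' K = Set.univ := by
  choose K hK hKx using fun x : X => exists_compact_mem_nhds x
  choose s hs using hf.surjective
  obtain ⟨t, -, ht⟩ := isCompact_univ.elim_nhds_subcover (fun y => f '' K (s y)) fun y _ => by
    conv_lhs => rw [← hs y]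
    exact hf.isOpenMap.image_mem_nhds (hKx _)
  refine ⟨⋃ y ∈ t, K (s y), t.isCompact_biUnion fun y _ => hK _, ?_⟩
  rw [Set.image_iUnion₂]
  exact Set.univ_subset_iff.1 ht

section Lattice

variable (Γ : Subgroup SU11)

lemma isQuotientMap_discQuotient_mk : Topology.IsQuotientMap (DiscQuotient.mk Γ) :=
  ⟨⟨rfl⟩, Quotient.mk''_surjective⟩

lemma isQuotientMap_bundleSpace_mk : Topology.IsQuotientMap (BundleSpace.mk Γ) :=
  ⟨⟨rfl⟩, Quotient.mk''_surjective⟩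

instance : ContinuousConstSMul Γ Disc := ⟨fun γ => continuous_const_smul (γ : SU11)⟩

instance : ContinuousConstSMul Γ Quadric := ⟨fun γ => continuous_const_smul (γ : SU11)⟩

variable {Γ} (hΓ : IsTorsionFreeUniformLattice Γ)
include hΓ

lemma properlyDiscontinuousSMul_disc : ProperlyDiscontinuousSMul Γ Disc where
  finite_disjoint_inter_image hK hL := by
    have := hΓ.discrete
    refine (Disc.finite_smul_mem Γ hK hL).subset ?_
    rintro γ ⟨_, ⟨z, hz, rfl⟩, hγz⟩
    exact ⟨z, hz, hγz⟩

/-- Project the compact sets to the disc: Γ need only be discontinuous on that factor. -/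
lemma properlyDiscontinuousSMul_prod : ProperlyDiscontinuousSMul Γ (Disc × Quadric) where
  finite_disjoint_inter_image hK hL := by
    have := hΓ.discrete
    refine (Disc.finite_smul_mem Γ (hK.image continuous_fst) (hL.image continuous_fst)).subset ?_
    rintro γ ⟨_, ⟨u, hu, rfl⟩, hγu⟩
    exact ⟨u.1, ⟨u, hu, rfl⟩, _, hγu, rfl⟩

lemma isQuotientCoveringMap_disc : IsQuotientCoveringMap (DiscQuotient.mk Γ) Γ := by
  have := properlyDiscontinuousSMul_disc hΓ
  have : IsCancelSMul Γ Disc := isCancelSMul_iff_eq_one_of_smul_eq.2 (Disc.smul_eq_self Γ hΓ)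
  exact (isQuotientMap_discQuotient_mk Γ).isQuotientCoveringMap_of_properlyDiscontinuousSMul
    Quotient.eq''

lemma isQuotientCoveringMap_bundle : IsQuotientCoveringMap (BundleSpace.mk Γ) Γ := by
  have := properlyDiscontinuousSMul_prod hΓ
  have : IsCancelSMul Γ (Disc × Quadric) := isCancelSMul_iff_eq_one_of_smul_eq.2 fun γ u hu =>
    Disc.smul_eq_self Γ hΓ γ u.1 (congrArg Prod.fst hu)
  exact (isQuotientMap_bundleSpace_mk Γ).isQuotientCoveringMap_of_properlyDiscontinuousSMul
    Quotient.eq''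

lemma t2Space_discQuotient : T2Space (DiscQuotient Γ) := by
  have := properlyDiscontinuousSMul_disc hΓ
  exact t2Space_of_properlyDiscontinuousSMul_of_t2Space (Γ := Γ) (T := Disc)

lemma t2Space_bundleSpace : T2Space (BundleSpace Γ) := by
  have := properlyDiscontinuousSMul_prod hΓ
  exact t2Space_of_properlyDiscontinuousSMul_of_t2Space (Γ := Γ) (T := Disc × Quadric)

lemma compactSpace_discQuotient : CompactSpace (DiscQuotient Γ) := by
  have := hΓ.cocompact
  let φ : SU11 ⧸ Γ → DiscQuotient Γ := Quotient.lift
    (fun g : SU11 => DiscQuotient.mk Γ (g⁻¹ • Disc.center)) (by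
      intro g h hgh
      have hmem : g⁻¹ * h ∈ Γ := QuotientGroup.leftRel_apply.1 hgh
      refine Quotient.sound ⟨⟨g⁻¹ * h, hmem⟩, ?_⟩
      change (g⁻¹ * h) • h⁻¹ • Disc.center = g⁻¹ • Disc.center
      rw [← mul_smul, mul_inv_cancel_right])
  have hφ : Continuous φ := by
    refine Continuous.quotient_lift ?_ _
    exact (isQuotientMap_discQuotient_mk Γ).continuous.comp
      (continuous_inv.smul continuous_const)
  refine Function.Surjective.compactSpace hφ ?_
  intro s
  obtain ⟨z, rfl⟩ := (isQuotientMap_discQuotient_mk Γ).surjective s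
  obtain ⟨g, rfl⟩ := Disc.exists_smul_center z
  exact ⟨QuotientGroup.mk g, rfl⟩

/-- If a compact K in the disc meets every orbit, then K × 𝒞 meets every orbit of the diagonal
action. -/
lemma compactSpace_bundleSpace : CompactSpace (BundleSpace Γ) := by
  have := compactSpace_discQuotient hΓ
  obtain ⟨K, hK, hKu⟩ :=
    (isQuotientCoveringMap_disc hΓ).isOpenQuotientMap.exists_isCompact_image_eq_univ
  have hp := isQuotientCoveringMap_bundle hΓ
  refine ⟨?_⟩
  convert (hK.prod (isCompact_univ (X := Quadric))).image hp.continuous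
  symm
  rw [Set.eq_univ_iff_forall]
  intro m
  obtain ⟨u, rfl⟩ := hp.surjective m
  obtain ⟨k, hk, hku⟩ : DiscQuotient.mk Γ u.1 ∈ DiscQuotient.mk Γ '' K := hKu ▸ Set.mem_univ _
  obtain ⟨γ, hγ⟩ := (isQuotientCoveringMap_disc hΓ).apply_eq_iff_mem_orbit.1 hku
  change γ • u.1 = k at hγ
  refine ⟨γ • u, ⟨?_, Set.mem_univ _⟩, hp.map_smul γ⟩
  rw [Prod.smul_fst, hγ]
  exact hk

end Lattice

/-! ## Coordinate expressions of the action -/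

instance (E : Type*) [NormedAddCommGroup E] [NormedSpace ℝ E] :
    ClosedUnderRestriction (holFoliationGroupoid E) := by
  rw [closedUnderRestriction_iff_id_le, StructureGroupoid.le_iff]
  rintro e ⟨s, hs, hes⟩
  refine (holFoliationGroupoid E).mem_of_eqOnSource ?_ hes
  have h : (holFoliationPregroupoid E).property id s :=
    ⟨contDiffOn_id, fun p _ => ⟨differentiableAt_id, Filter.Eventually.of_forall fun _ => rfl⟩⟩
  exact ⟨h, h⟩

lemma Disc.coe_of_mem_atlas {e : OpenPartialHomeomorph Disc ℂ} (he : e ∈ atlas ℂ Disc) (z : Disc) :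
    e z = z ∧ z ∈ e.source := by
  obtain ⟨x, hx⟩ := Set.mem_iUnion.1 he
  obtain rfl := Set.mem_singleton_iff.1 hx
  exact ⟨rfl, by simp [chartAt_self_eq]⟩

lemma Disc.mem_target_iff {e : OpenPartialHomeomorph Disc ℂ} (he : e ∈ atlas ℂ Disc) {u : ℂ} :
    u ∈ e.target ↔ u ∈ Disc := by
  constructor
  · intro hu
    rw [← e.right_inv hu, (Disc.coe_of_mem_atlas he _).1]
    exact (e.symm u).2
  · intro hu
    have h := Disc.coe_of_mem_atlas he ⟨u, hu⟩
    have h2 := e.map_source h.2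
    rwa [h.1] at h2

lemma Disc.symm_eq {e : OpenPartialHomeomorph Disc ℂ} (he : e ∈ atlas ℂ Disc) {u : ℂ}
    (hu : u ∈ Disc) : e.symm u = ⟨u, hu⟩ := by
  have h := Disc.coe_of_mem_atlas he ⟨u, hu⟩
  conv_lhs => rw [show u = e ⟨u, hu⟩ from h.1.symm]
  exact e.left_inv h.2

section Moebius

variable {𝕜 : Type*} [NontriviallyNormedField 𝕜] [NormedAlgebra 𝕜 ℂ]

lemma ContDiffOn.div_complex {V : Type*} [NormedAddCommGroup V] [NormedSpace 𝕜 V] {n : ℕ∞ω}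
    {f g : V → ℂ} {s : Set V} (hf : ContDiffOn 𝕜 n f s) (hg : ContDiffOn 𝕜 n g s)
    (h0 : ∀ x ∈ s, g x ≠ 0) : ContDiffOn 𝕜 n (fun x => f x / g x) s := by
  simp only [div_eq_mul_inv]
  exact hf.mul (hg.inv h0)

lemma contDiffOn_moebius (g : SU11) : ContDiffOn 𝕜 ω (fun z : ℂ =>
    (SU11.a g * z + SU11.b g) / (conj (SU11.b g) * z + conj (SU11.a g))) (Disc : Set ℂ) :=
  ((contDiff_const.mul contDiff_id).add contDiff_const).contDiffOn.div_complex
    ((contDiff_const.mul contDiff_id).add contDiff_const).contDiffOn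
    fun z hz => Disc.denom_ne g ⟨z, hz⟩

/-- The field 𝕜 is left open: ℂ serves the base and the leaves, ℝ the real-analytic structure of the
total space. -/
lemma contDiffOn_disc_smul (g : SU11) {e e' : OpenPartialHomeomorph Disc ℂ}
    (he : e ∈ atlas ℂ Disc) (he' : e' ∈ atlas ℂ Disc) :
    ContDiffOn 𝕜 ω (fun z : ℂ => e' (g • e.symm z)) (Disc : Set ℂ) := by
  refine (contDiffOn_moebius g).congr fun z hz => ?_
  rw [Disc.symm_eq he hz, (Disc.coe_of_mem_atlas he' _).1]
  rfl

end Moebius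

variable {Γ : Subgroup SU11}

lemma disc_smulInCharts_mem (γ : Γ) {e e' : OpenPartialHomeomorph Disc ℂ}
    (he : e ∈ atlas ℂ Disc) (he' : e' ∈ atlas ℂ Disc) :
    smulInCharts γ e e' ∈ contDiffGroupoid ω 𝓘(ℂ) := by
  have key : ∀ (γ : Γ) {e e' : OpenPartialHomeomorph Disc ℂ} (_ : e ∈ atlas ℂ Disc)
      (_ : e' ∈ atlas ℂ Disc),
      ContDiffOn ℂ ω (smulInCharts γ e e') (smulInCharts γ e e').source := fun γ e e' he he' =>
    (contDiffOn_disc_smul γ.1 he he').mono fun z hz =>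
      (Disc.mem_target_iff he).1 (mem_smulInCharts_source.1 hz).1
  rw [mem_contDiffGroupoid_self]
  refine ⟨key γ he he', ?_⟩
  rw [smulInCharts_symm, ← OpenPartialHomeomorph.symm_source, smulInCharts_symm]
  exact key γ⁻¹ he' he

/-- The action is diagonal: the first coordinate is Möbius in z, hence holomorphic, and the second
does not involve z. -/
lemma bundle_smulInCharts_mem (γ : Γ)
    {e e' : OpenPartialHomeomorph (Disc × Quadric) (ModelProd ℂ (EuclideanSpace ℝ (Fin 3)))}
    (he : e ∈ atlas (ModelProd ℂ (EuclideanSpace ℝ (Fin 3))) (Disc × Quadric))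
    (he' : e' ∈ atlas (ModelProd ℂ (EuclideanSpace ℝ (Fin 3))) (Disc × Quadric)) :
    smulInCharts γ e e' ∈ holFoliationGroupoid (EuclideanSpace ℝ (Fin 3)) := by
  have key : ∀ (γ : Γ)
      {e e' : OpenPartialHomeomorph (Disc × Quadric) (ModelProd ℂ (EuclideanSpace ℝ (Fin 3)))}
      (_ : e ∈ atlas (ModelProd ℂ (EuclideanSpace ℝ (Fin 3))) (Disc × Quadric))
      (_ : e' ∈ atlas (ModelProd ℂ (EuclideanSpace ℝ (Fin 3))) (Disc × Quadric)),
      (holFoliationPregroupoid (EuclideanSpace ℝ (Fin 3))).property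
        (smulInCharts γ e e') (smulInCharts γ e e').source := by
    rintro γ _ _ ⟨e, he, _, ⟨ζ, rfl⟩, rfl⟩ ⟨e', he', _, ⟨ζ', rfl⟩, rfl⟩
    have hs : ∀ p ∈ (smulInCharts γ (e.prod (quadricChart ζ)) (e'.prod (quadricChart ζ'))).source,
        p.1 ∈ (Disc : Set ℂ) ∧ γ.1 • (quadricChart ζ).symm p.2 ∈ (quadricChart ζ').source := by
      intro p hp
      obtain ⟨h1, h2⟩ := mem_smulInCharts_source.1 hp
      exact ⟨(Disc.mem_target_iff he).1 h1.1, h2.2⟩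
    have hz : ContDiffOn ℝ ω (fun z : ℂ => e' (γ.1 • e.symm z)) (Disc : Set ℂ) :=
      contDiffOn_disc_smul γ.1 he he'
    refine ⟨?_, fun p hp => ⟨?_, Filter.Eventually.of_forall fun _ => rfl⟩⟩
    · exact (hz.comp contDiffOn_fst fun p hp => (hs p hp).1).prodMk
        ((contDiffOn_quadricChart_smul γ.1 ζ ζ').comp contDiffOn_snd fun p hp => (hs p hp).2)
    · have h : ContDiffOn ℂ ω (fun z : ℂ => e' (γ.1 • e.symm z)) (Disc : Set ℂ) :=
        contDiffOn_disc_smul γ.1 he he'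
      exact (h.contDiffAt (Disc.2.mem_nhds (hs p hp).1)).differentiableAt (by simp)
  refine ⟨key γ he he', ?_⟩
  rw [smulInCharts_symm, ← OpenPartialHomeomorph.symm_source, smulInCharts_symm]
  exact key γ⁻¹ he' he

/-! ## The foliated bundle -/

lemma IsQuotientCoveringMap.isLocalDiffeomorph {Γ H V X Y 𝕜 : Type*} [Group Γ]
    [NontriviallyNormedField 𝕜] [NormedAddCommGroup V] [NormedSpace 𝕜 V] [TopologicalSpace H]
    [TopologicalSpace X] [TopologicalSpace Y] [MulAction Γ X] [ChartedSpace H X]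
    [ContinuousConstSMul Γ X] {p : X → Y} (hp : IsQuotientCoveringMap p Γ)
    (I : ModelWithCorners 𝕜 V H) (n : ℕ∞ω)
    (hG : ∀ γ : Γ, ∀ e ∈ atlas H X, ∀ e' ∈ atlas H X,
      smulInCharts γ e e' ∈ contDiffGroupoid n I) :
    letI := hp.chartedSpace H
    IsManifold I n X → IsLocalDiffeomorph I I n p := by
  let _ := hp.chartedSpace H
  intro hX x
  have hY : IsManifold I n Y := { hp.hasGroupoid _ hG with }
  obtain ⟨q, hx, hq⟩ := hp.isCoveringMap.isLocalHomeomorph x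
  have hl : ChartedSpace.LiftPropOn (contDiffGroupoid n I).IsLocalStructomorphWithinAt p q.source :=
    StructureGroupoid.LocalInvariantProp.liftPropOn_of_liftProp
      (fun s x t f hts h hx =>
        let ⟨e, he, heq, hxe⟩ := h (hts hx)
        ⟨e, he, heq.mono (Set.inter_subset_inter_left _ hts), hxe⟩)
      (hp.liftProp (contDiffGroupoid n I) hG)
  rw [hq] at hl
  obtain ⟨h1, h2⟩ := (isLocalStructomorphOn_contDiffGroupoid_iff q).1 hl
  exact ⟨⟨q.toPartialEquiv, q.open_source, q.open_target, h1, h2⟩, hx, fun y _ => congrFun hq y⟩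

lemma isAnalyticFoliatedBundle_bundleSpace (hΓ : IsTorsionFreeUniformLattice Γ) :
    letI := (isQuotientCoveringMap_disc hΓ).chartedSpace ℂ
    letI := (isQuotientCoveringMap_bundle hΓ).chartedSpace
      (ModelProd ℂ (EuclideanSpace ℝ (Fin 3)))
    IsAnalyticFoliatedBundle Γ (EuclideanSpace ℝ (Fin 3))
      (DiscQuotient.mk Γ) (BundleSpace.mk Γ) := by
  have hπ := isQuotientCoveringMap_disc hΓ
  have hp := isQuotientCoveringMap_bundle hΓ
  let _ := hπ.chartedSpace ℂ
  let _ := hp.chartedSpace (ModelProd ℂ (EuclideanSpace ℝ (Fin 3)))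
  have hGπ : ∀ γ : Γ, ∀ e ∈ atlas ℂ Disc, ∀ e' ∈ atlas ℂ Disc,
    smulInCharts γ e e' ∈ contDiffGroupoid ω 𝓘(ℂ) := fun γ e he e' he' =>
      disc_smulInCharts_mem γ he he'
  have hGp : ∀ γ : Γ, ∀ e ∈ atlas (ModelProd ℂ (EuclideanSpace ℝ (Fin 3))) (Disc × Quadric),
    ∀ e' ∈ atlas (ModelProd ℂ (EuclideanSpace ℝ (Fin 3))) (Disc × Quadric),
    smulInCharts γ e e' ∈ holFoliationGroupoid (EuclideanSpace ℝ (Fin 3)) :=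
      fun γ e he e' he' => bundle_smulInCharts_mem γ he he'
  refine
    { base := ⟨t2Space_discQuotient hΓ, compactSpace_discQuotient hΓ,
        hπ.surjective.connectedSpace hπ.continuous, { hπ.hasGroupoid _ hGπ with }⟩
      simplyConnected := inferInstance
      covering := hπ.isCoveringMap
      covering_holomorphic := hπ.isLocalDiffeomorph 𝓘(ℂ) ω hGπ inferInstance
      covering_surjective := hπ.surjective
      covering_orbits := fun z w => ?_
      deck_continuous := fun γ => continuous_const_smul γ
      deck_free := Disc.smul_eq_self Γ hΓ
      fibre_t2 := inferInstance
      fibre_compact := inferInstance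
      fibre_connected := inferInstance
      fibre_manifold := inferInstance
      fibre_action := fun γ => contMDiff_quadric_smul γ.1
      total := ⟨t2Space_bundleSpace hΓ, compactSpace_bundleSpace hΓ,
        hp.surjective.connectedSpace hp.continuous, hp.hasGroupoid _ hGp⟩
      total_quotient := hp.toIsQuotientMap
      total_orbits := fun u v => ?_
      total_local_iso := hp.liftProp _ hGp
      leaf_eq := fun z x => hp.leaf_eq z x
      bundle := hp.exists_bundle hπ }
  · rw [eq_comm]
    exact hπ.apply_eq_iff_mem_orbit
  · rw [eq_comm]
    exact hp.apply_eq_iff_mem_orbit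

/-! ## The leafwise holomorphic function -/

lemma discQuadricFun_mk (z : Disc) (v : HomCoords) (hv : v ≠ 0)
    (h : Projectivization.mk ℝ v hv ∈ quadric) :
    discQuadricFun z ⟨Projectivization.mk ℝ v hv, h⟩ =
      (conj v.1 * (z : ℂ) - v.2.1) / (-conj v.2.1 * (z : ℂ) + v.1) := rfl

/-- Numerator and denominator are both divided by the automorphy factor D = β̄z + ᾱ of g, which
cancels. The computation is that of (gh)⁻¹(gz) = h⁻¹z, but needs no condition on t. -/
lemma discQuadricFun_smul (g : SU11) (z : Disc) (p : Quadric) :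
    discQuadricFun (g • z) (g • p) = discQuadricFun z p := by
  obtain ⟨p, hp⟩ := p
  revert hp
  refine Projectivization.ind (fun v hv => ?_) p
  intro hp
  have hd := Disc.denom_ne g z
  have hdet : SU11.a g * conj (SU11.a g) - SU11.b g * conj (SU11.b g) = 1 := by
    rw [Complex.mul_conj, Complex.mul_conj]
    exact_mod_cast SU11.normSq_sub g
  change (conj (SU11.a g * v.1 + SU11.b g * conj v.2.1) *
      ((SU11.a g * (z : ℂ) + SU11.b g) / (conj (SU11.b g) * (z : ℂ) + conj (SU11.a g))) -
        (SU11.a g * v.2.1 + SU11.b g * conj v.1)) /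
      (-conj (SU11.a g * v.2.1 + SU11.b g * conj v.1) *
      ((SU11.a g * (z : ℂ) + SU11.b g) / (conj (SU11.b g) * (z : ℂ) + conj (SU11.a g))) +
        (SU11.a g * v.1 + SU11.b g * conj v.2.1)) =
    (conj v.1 * (z : ℂ) - v.2.1) / (-conj v.2.1 * (z : ℂ) + v.1)
  simp only [map_add, map_mul, Complex.conj_conj]
  set D := conj (SU11.b g) * (z : ℂ) + conj (SU11.a g) with hD
  have hN : (conj (SU11.a g) * conj v.1 + conj (SU11.b g) * v.2.1) *
      ((SU11.a g * (z : ℂ) + SU11.b g) / D) - (SU11.a g * v.2.1 + SU11.b g * conj v.1) =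
      (conj v.1 * (z : ℂ) - v.2.1) / D := by
    rw [eq_div_iff hd, sub_mul, mul_assoc, div_mul_cancel₀ _ hd, hD]
    linear_combination (conj v.1 * (z : ℂ) - v.2.1) * hdet
  have hM : -(conj (SU11.a g) * conj v.2.1 + conj (SU11.b g) * v.1) *
      ((SU11.a g * (z : ℂ) + SU11.b g) / D) + (SU11.a g * v.1 + SU11.b g * conj v.2.1) =
      (-conj v.2.1 * (z : ℂ) + v.1) / D := by
    rw [eq_div_iff hd, add_mul, mul_assoc, div_mul_cancel₀ _ hd, hD]
    linear_combination (-conj v.2.1 * (z : ℂ) + v.1) * hdet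
  rw [hN, hM, div_div_div_cancel_right₀ hd]

lemma discQuadricFun_denom_ne {v : HomCoords} (hv : v ≠ 0) (hQ : OnQuadric v) (z : Disc) :
    -conj v.2.1 * (z : ℂ) + v.1 ≠ 0 := by
  intro h
  have h0 := norm_pos_iff.2 (fst_ne_zero_of_onQuadric hv hQ)
  have h1 : v.1 = conj v.2.1 * (z : ℂ) := by linear_combination h
  have h2 : ‖v.1‖ = ‖v.2.1‖ * ‖(z : ℂ)‖ := by rw [h1, norm_mul, Complex.norm_conj]
  have h3 : ‖v.2.1‖ ≤ ‖v.1‖ := by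
    rw [OnQuadric] at hQ
    nlinarith [sq_nonneg v.2.2, norm_nonneg v.2.1]
  nlinarith [Disc.norm_lt_one z, norm_nonneg v.2.1, norm_nonneg (z : ℂ)]

/-- Homogeneous coordinates of `quadricPoint`. -/
def quadricRep (ζ : Circle) (y : EuclideanSpace ℝ (Fin 3)) : HomCoords :=
  (lightCoords ζ).symm ((0 : Fin (4 + 1)).insertNth 1 fun j => euclideanSnoc (y, lightForm y) j)

lemma contDiff_quadricRep (ζ : Circle) : ContDiff ℝ ω (quadricRep ζ) :=
  (lightCoords ζ).symm.contDiff.comp ((contDiff_insertNth_one 0).comp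
    (euclideanSnoc.contDiff.comp (contDiff_id.prodMk contDiff_lightForm)))

lemma quadricRep_ne_zero (ζ : Circle) (y : EuclideanSpace ℝ (Fin 3)) : quadricRep ζ y ≠ 0 := by
  intro h
  have h1 := (lightCoords ζ).symm.map_eq_zero_iff.1 h
  simpa using congrFun h1 0

lemma onQuadric_quadricRep (ζ : Circle) (y : EuclideanSpace ℝ (Fin 3)) :
    OnQuadric (quadricRep ζ y) := (quadricPoint ζ y).2

lemma discQuadricFun_quadricPoint (z : Disc) (ζ : Circle) (y : EuclideanSpace ℝ (Fin 3)) :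
    discQuadricFun z (quadricPoint ζ y) =
      (conj (quadricRep ζ y).1 * (z : ℂ) - (quadricRep ζ y).2.1) /
        (-conj (quadricRep ζ y).2.1 * (z : ℂ) + (quadricRep ζ y).1) := rfl

/-- The coordinate expression of `discQuadricFun` is real-analytic. -/
lemma contDiffOn_discQuadricFun (ζ : Circle) :
    ContDiffOn ℝ ω (fun p : ℂ × EuclideanSpace ℝ (Fin 3) =>
      (conj (quadricRep ζ p.2).1 * p.1 - (quadricRep ζ p.2).2.1) /
        (-conj (quadricRep ζ p.2).2.1 * p.1 + (quadricRep ζ p.2).1))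
      ((Disc : Set ℂ) ×ˢ Set.univ) := by
  have hr : ContDiff ℝ ω fun p : ℂ × EuclideanSpace ℝ (Fin 3) => quadricRep ζ p.2 :=
    (contDiff_quadricRep ζ).comp contDiff_snd
  have h1 := contDiff_fst.comp hr
  have h2 := contDiff_fst.comp (contDiff_snd.comp hr)
  have c1 := Complex.conjCLE.contDiff.comp h1
  have c2 := Complex.conjCLE.contDiff.comp h2
  refine ((c1.mul contDiff_fst).sub h2).contDiffOn.div_complex
    ((c2.neg.mul contDiff_fst).add h1).contDiffOn fun p hp => ?_
  exact discQuadricFun_denom_ne (quadricRep_ne_zero ζ p.2) (onQuadric_quadricRep ζ p.2) ⟨p.1, hp.1⟩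

/-- In charts of the disc and of the quadric, `discQuadricFun` is a rational expression. -/
lemma discQuadricFun_symm {e : OpenPartialHomeomorph Disc ℂ} (he : e ∈ atlas ℂ Disc) (ζ : Circle)
    {u : ℂ} (hu : u ∈ Disc) (y : EuclideanSpace ℝ (Fin 3)) :
    discQuadricFun (e.symm u) ((quadricChart ζ).symm y) =
      (conj (quadricRep ζ y).1 * u - (quadricRep ζ y).2.1) /
        (-conj (quadricRep ζ y).2.1 * u + (quadricRep ζ y).1) := by
  rw [Disc.symm_eq he hu]
  exact discQuadricFun_quadricPoint ⟨u, hu⟩ ζ y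

variable (Γ) in
/-- The function induced by `discQuadricFun` on the foliated bundle. -/
def bundleFun : BundleSpace Γ → ℂ :=
  Quotient.lift (fun p : Disc × Quadric => discQuadricFun p.1 p.2) (by
    rintro _ p ⟨γ, rfl⟩
    exact discQuadricFun_smul γ.1 p.1 p.2)

lemma bundleFun_mk (z : Disc) (p : Quadric) :
    bundleFun Γ (BundleSpace.mk Γ (z, p)) = discQuadricFun z p := rfl

lemma realAnalytic_bundleFun (hΓ : IsTorsionFreeUniformLattice Γ) :
    letI := (isQuotientCoveringMap_bundle hΓ).chartedSpace
      (ModelProd ℂ (EuclideanSpace ℝ (Fin 3)))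
    RealAnalytic (EuclideanSpace ℝ (Fin 3)) (bundleFun Γ) := by
  have hp := isQuotientCoveringMap_bundle hΓ
  let _ := hp.chartedSpace (ModelProd ℂ (EuclideanSpace ℝ (Fin 3)))
  intro m
  have hmem := mem_chart_source (ModelProd ℂ (EuclideanSpace ℝ (Fin 3))) m
  obtain ⟨e', ⟨e, he, _, ⟨ζ, rfl⟩, rfl⟩, ht, hsymm⟩ :=
    hp.exists_of_mem_atlas (chart_mem_atlas (ModelProd ℂ (EuclideanSpace ℝ (Fin 3))) m)
  set c := chartAt (ModelProd ℂ (EuclideanSpace ℝ (Fin 3))) m with hc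
  have hF : ∀ u : ModelProd ℂ (EuclideanSpace ℝ (Fin 3)), u.1 ∈ Disc →
      bundleFun Γ (c.symm u) = (conj (quadricRep ζ u.2).1 * u.1 - (quadricRep ζ u.2).2.1) /
        (-conj (quadricRep ζ u.2).2.1 * u.1 + (quadricRep ζ u.2).1) := by
    intro u hu
    rw [hsymm u]
    exact discQuadricFun_symm he ζ hu u.2
  have ho : IsOpen ((Disc : Set ℂ) ×ˢ (Set.univ : Set (EuclideanSpace ℝ (Fin 3)))) :=
    Disc.2.prod isOpen_univ
  have hcm : c m ∈ (Disc : Set ℂ) ×ˢ (Set.univ : Set (EuclideanSpace ℝ (Fin 3))) :=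
    ⟨(Disc.mem_target_iff he).1 (ht (c.map_source hmem)).1, Set.mem_univ _⟩
  have hcd : ContDiffAt ℝ ω (fun u : ℂ × EuclideanSpace ℝ (Fin 3) => bundleFun Γ (c.symm u))
      (c m) := by
    refine ((contDiffOn_discQuadricFun ζ).contDiffAt (ho.mem_nhds hcm)).congr_of_eventuallyEq ?_
    filter_upwards [ho.mem_nhds hcm] with u hu
    exact hF u hu.1
  rw [contMDiffAt_iff]
  refine ⟨?_, hcd.contDiffWithinAt⟩
  have h1 : ContinuousAt (fun m' => bundleFun Γ (c.symm (c m'))) m :=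
    ContinuousAt.comp (g := fun u => bundleFun Γ (c.symm u)) hcd.continuousAt
      (c.continuousAt hmem)
  refine h1.congr ?_
  filter_upwards [c.open_source.mem_nhds hmem] with m' hm'
  rw [c.left_inv hm']

lemma leafwiseHolomorphic_bundleFun (hΓ : IsTorsionFreeUniformLattice Γ) :
    letI := (isQuotientCoveringMap_bundle hΓ).chartedSpace
      (ModelProd ℂ (EuclideanSpace ℝ (Fin 3)))
    LeafwiseHolomorphic (EuclideanSpace ℝ (Fin 3)) (bundleFun Γ) := by
  have hp := isQuotientCoveringMap_bundle hΓ
  let _ := hp.chartedSpace (ModelProd ℂ (EuclideanSpace ℝ (Fin 3)))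
  intro c hc u hu
  obtain ⟨e', ⟨e, he, _, ⟨ζ, rfl⟩, rfl⟩, ht, hsymm⟩ := hp.exists_of_mem_atlas hc
  have hu1 : u.1 ∈ Disc := (Disc.mem_target_iff he).1 (ht hu).1
  have hd := discQuadricFun_denom_ne (quadricRep_ne_zero ζ u.2) (onQuadric_quadricRep ζ u.2)
    ⟨u.1, hu1⟩
  have h : DifferentiableAt ℂ (fun w : ℂ =>
      (conj (quadricRep ζ u.2).1 * w - (quadricRep ζ u.2).2.1) /
        (-conj (quadricRep ζ u.2).2.1 * w + (quadricRep ζ u.2).1)) u.1 :=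
    DifferentiableAt.div (by fun_prop) (by fun_prop) hd
  refine h.congr_of_eventuallyEq ?_
  filter_upwards [Disc.2.mem_nhds hu1] with w hw
  rw [hsymm (w, u.2)]
  exact discQuadricFun_symm he ζ hw u.2

lemma not_leafwiseConstant_bundleFun (hΓ : IsTorsionFreeUniformLattice Γ) :
    letI := (isQuotientCoveringMap_bundle hΓ).chartedSpace
      (ModelProd ℂ (EuclideanSpace ℝ (Fin 3)))
    ¬ LeafwiseConstant (EuclideanSpace ℝ (Fin 3)) (bundleFun Γ) := by
  have hp := isQuotientCoveringMap_bundle hΓ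
  let _ := hp.chartedSpace (ModelProd ℂ (EuclideanSpace ℝ (Fin 3)))
  intro hconst
  -- [1, 0, 1] corresponds to the identity matrix, and on its leaf the function is z.
  have hv : ((1, 0, 1) : HomCoords) ≠ 0 := fun h => one_ne_zero (congrArg Prod.fst h)
  have hQ : Projectivization.mk ℝ ((1, 0, 1) : HomCoords) hv ∈ quadric := by
    rw [mk_mem_quadric, OnQuadric]
    simp
  let x : Quadric := ⟨_, hQ⟩
  have hf : ∀ z : Disc, discQuadricFun z x = z := fun z => by
    rw [discQuadricFun_mk]
    simp
  let w : Disc := ⟨1 / 2, by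
    change (1 / 2 : ℂ) ∈ Metric.ball (0 : ℂ) 1
    rw [mem_ball_zero_iff]
    norm_num⟩
  have h := hconst (BundleSpace.mk Γ (Disc.center, x)) (BundleSpace.mk Γ (w, x)) (by
    rw [hp.leaf_eq]
    exact ⟨w, rfl⟩)
  rw [bundleFun_mk, bundleFun_mk, hf, hf] at h
  simp [w, Disc.center] at h

end

theorem mainTheorem2 :
    -- torsion-free uniform lattices exist, and the function is invariant
    (∃ Γ : Subgroup SU11, IsTorsionFreeUniformLattice Γ) ∧
    (∀ (g : SU11) (z : Disc) (p : Quadric), discQuadricFun (g • z) (g • p) = discQuadricFun z p) ∧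
    -- the quadric is a real-analytic submanifold of dimension three
    ∃ _ : ChartedSpace (EuclideanSpace ℝ (Fin 3)) Quadric,
      IsManifold 𝓘(ℝ, EuclideanSpace ℝ (Fin 3)) ω Quadric ∧
      Manifold.IsSmoothEmbedding 𝓘(ℝ, EuclideanSpace ℝ (Fin 3)) 𝓘(ℝ, EuclideanSpace ℝ (Fin 4)) ω
        (Subtype.val : Quadric → RP4) ∧
      -- each torsion-free uniform lattice gives an example
      ∀ Γ : Subgroup SU11, IsTorsionFreeUniformLattice Γ →
        ∃ (_ : ChartedSpace ℂ (DiscQuotient Γ))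
          (_ : ChartedSpace (ModelProd ℂ (EuclideanSpace ℝ (Fin 3))) (BundleSpace Γ)),
          IsAnalyticFoliatedBundle Γ (EuclideanSpace ℝ (Fin 3))
            (DiscQuotient.mk Γ) (BundleSpace.mk Γ) ∧
          ∃ F : BundleSpace Γ → ℂ,
            (∀ (z : Disc) (p : Quadric), F (BundleSpace.mk Γ (z, p)) = discQuadricFun z p) ∧
            RealAnalytic (EuclideanSpace ℝ (Fin 3)) F ∧
            LeafwiseHolomorphic (EuclideanSpace ℝ (Fin 3)) F ∧
            ¬ LeafwiseConstant (EuclideanSpace ℝ (Fin 3)) F := by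

  refine ⟨⟨_, isTorsionFreeUniformLattice_congruenceLattice⟩, discQuadricFun_smul,
    inferInstance, inferInstance, isSmoothEmbedding_quadric_val, fun Γ hΓ => ?_⟩
  exact ⟨(isQuotientCoveringMap_disc hΓ).chartedSpace ℂ,
    (isQuotientCoveringMap_bundle hΓ).chartedSpace _,
    isAnalyticFoliatedBundle_bundleSpace hΓ, bundleFun Γ, bundleFun_mk,
    realAnalytic_bundleFun hΓ, leafwiseHolomorphic_bundleFun hΓ,
    not_leafwiseConstant_bundleFun hΓ⟩
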